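/- Theorem 1 (cf. Conjecture 3.9 of Stanley–Zanello). For integers $n,b,\ell\ge 0$ let $c_{n,b}(\ell)$ be the number of partitions of $\ell$ into at most $b$ distinct parts, each of size at most $n$, that is, of partitions $\lambda_1>\cdots>\lambda_r>0$ with $r\le b$, $\lambda_1\le n$ and $\sum_i\lambda_i=\ell$. Let $$F_{\lambda_{n,b}}(q)=\sum_{\ell\ge 0}c_{n,b}(\ell)\,q^\ell$$ be the rank-generating polynomial. Then $$F_{\lambda_{n,b}}(q)=\sum_{a=0}^{b}q^{a(a+1)/2}\binom{n}{a}_q\quad\text{for all } n,b\ge 0,\qquad\text{where } \binom{n}{a}_q=\frac{\prod_{k=0}^{a-1}(1-q^{n-k})}{\prod_{k=1}^{a}(1-q^k)}$$ is the Gaussian binomial coefficient (equal to $0$ if $a>n$). Moreover, for every $b$ there is an $N=N(b)$ such that for all $n\ge N$ the polynomial $F_{\lambda_{n,b}}$ is unimodal: there is an index $k$ with $$c_{n,b}(0)\le c_{n,b}(1)\le\cdots\le c_{n,b}(k)\ge c_{n,b}(k+1)\ge\cdots.$$ -/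

import Mathlib

/-- The number of partitions of `l` into at most `b` distinct parts, each of size at most `n`;
that is, of partitions `μ₁ > ⋯ > μ_r` of `l` with `r ≤ b` and `μ₁ ≤ n`. -/
def truncatedStaircaseCount (n b l : ℕ) : ℕ :=
  ((Nat.Partition.distincts l).filter
    (fun p => p.parts.card ≤ b ∧ ∀ i ∈ p.parts, i ≤ n)).card

/-- There are no such partitions of `l` when `l > b * n`. -/
theorem truncatedStaircaseCount_eq_zero {n b l : ℕ} (h : b * n < l) :
    truncatedStaircaseCount n b l = 0 := by
  unfold truncatedStaircaseCount
  rw [Finset.card_eq_zero, Finset.filter_eq_empty_iff]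
  rintro p - ⟨hb, hn⟩
  have h1 : p.parts.sum ≤ p.parts.card • n := Multiset.sum_le_card_nsmul _ _ hn
  rw [p.parts_sum, smul_eq_mul] at h1
  have h2 := Nat.mul_le_mul_right n hb
  omega

/-- The rank-generating polynomial, the sum over all `l ≥ 0` of
`truncatedStaircaseCount n b l * q ^ l` (the terms with `l > b * n` vanish). -/
noncomputable def rankGeneratingPoly (n b : ℕ) : Polynomial ℕ :=
  ∑ l ∈ Finset.range (b * n + 1), Polynomial.monomial l (truncatedStaircaseCount n b l)

theorem coeff_rankGeneratingPoly (n b l : ℕ) :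
    (rankGeneratingPoly n b).coeff l = truncatedStaircaseCount n b l := by
  unfold rankGeneratingPoly
  rw [Polynomial.finsetSum_coeff]
  simp only [Polynomial.coeff_monomial, Finset.sum_ite_eq', Finset.mem_range]
  split_ifs with h
  · rfl
  · exact (truncatedStaircaseCount_eq_zero (by omega)).symm

/-- The Gaussian binomial coefficient, as a rational function in the variable `q`. For `b > n`
the numerator contains the factor `1 - q ^ 0 = 0`, so the value is `0`. -/
noncomputable def gaussianBinomial (n b : ℕ) : RatFunc ℚ :=
  (∏ k ∈ Finset.range b, (1 - RatFunc.X ^ (n - k))) /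
    (∏ k ∈ Finset.Icc 1 b, (1 - RatFunc.X ^ k))

/-- A sequence of natural numbers is unimodal if it increases weakly up to some index `k` and
decreases weakly from there on. -/
def IsUnimodalSeq (a : ℕ → ℕ) : Prop :=
  ∃ k : ℕ, MonotoneOn a (Set.Iic k) ∧ AntitoneOn a (Set.Ici k)

/-- A polynomial with natural number coefficients is unimodal if its coefficients, in increasing
order of degree, form a unimodal sequence. (The zeros beyond the degree do not matter, since the
coefficients are nonnegative.) -/
def IsUnimodalPoly (p : Polynomial ℕ) : Prop :=
  IsUnimodalSeq (fun l => p.coeff l)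

/-! A partition into distinct parts is a set, so the rank-generating polynomial is the sum over `a ≤
b` of e_a = `subsetSumPoly a n`, the elementary symmetric polynomial evaluated at q, q², …, qⁿ.
Splitting by whether the largest element `n` is used gives a recursion that matches q-Pascal, hence
the product formula (`algebraMap_subsetSumPoly`).

For unimodality the exponents fall into three ranges. Below `n` the coefficients rise
(`truncatedCoeff_le_succ`), by a recursion that splits on whether 1 is used. Past `(b - 1) * (n +
1)` only e_b is left; it is symmetric, so the coefficients fall (`truncatedCoeff_succ_le`).

In the middle range, let P = `powerSumPoly 1 n`. Newton's identities give e_b = P^b / b! plus terms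
containing higher power sums (`isPowerSumRemainder_subsetSumPoly_sub`). Since (1 - q) P = q (1 -
qⁿ), each difference operator removes one factor P. So the first differences of the coefficients
are, up to the factor b!, c(l) - c(l - n) with c the coefficients of P^(b-1), and the error is
O(n^(b-3)). The second differences are c'(l) - 2 c'(l - n) + c'(l - 2n) with c' the coefficients of
P^(b-2), and the error is O(n^(b-4)). Coefficients of powers of P are symmetric and drop away from
the centre at a definite rate (`exists_pow_le_powerCoeff_sub`). Hence for large `n` the first
difference is nonnegative well left of the centre and nonpositive well right of it, while near the
centre the second difference is nonpositive. A descent is then never followed by an ascent, which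
suffices by `isUnimodalPoly_of_no_valley`.

The bound on the second difference needs `5 ≤ b`. For `b ≤ 4` the peak is located from closed forms
for the coefficients of products of power sums. -/

/-- The generating polynomial of the `a`-element subsets of `{1, …, n}` by their sum. -/
noncomputable def subsetSumPoly (a n : ℕ) : Polynomial ℚ :=
  ∑ S ∈ (Finset.Icc 1 n).powersetCard a, Polynomial.X ^ (∑ i ∈ S, i)

/-- The power sum `∑ i ∈ {1, …, n}, q ^ (k * i)`. -/
noncomputable def powerSumPoly (k n : ℕ) : Polynomial ℚ :=
  ∑ i ∈ Finset.Icc 1 n, Polynomial.X ^ (k * i)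

/-! ### Partitions as subsets, and the two recursions -/

theorem truncatedStaircaseCount_eq_card (n b l : ℕ) :
    truncatedStaircaseCount n b l =
      (((Finset.Icc 1 n).powerset).filter (fun S => S.card ≤ b ∧ ∑ i ∈ S, i = l)).card := by
  unfold truncatedStaircaseCount
  refine Finset.card_bij' (fun p _ => p.parts.toFinset)
    -- The value in the `else` branch is never used: every set in the filter meets the condition.
    (fun S _ => if h : (∀ i ∈ S, 0 < i) ∧ ∑ i ∈ S, i = l then
      ⟨S.val, fun {i} hi => h.1 i hi, by rw [← h.2, Finset.sum, Multiset.map_id']⟩ else Nat.Partition.indiscrete l)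
    ?_ ?_ ?_ ?_
  · intro p hp
    simp only [Finset.mem_filter, Nat.Partition.distincts, Finset.mem_univ, true_and] at hp
    obtain ⟨hnd, hc, hn⟩ := hp
    simp only [Finset.mem_filter, Finset.mem_powerset]
    refine ⟨fun i hi => ?_, ?_, ?_⟩
    · rw [Multiset.mem_toFinset] at hi
      exact Finset.mem_Icc.2 ⟨p.parts_pos hi, hn i hi⟩
    · rwa [Multiset.toFinset_card_of_nodup hnd]
    · have := p.parts_sum
      rw [Finset.sum, Multiset.toFinset_val, hnd.dedup]
      simpa using this
  · intro S hS
    simp only [Finset.mem_filter, Finset.mem_powerset] at hS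
    obtain ⟨h1, h2, h3⟩ := hS
    have hpos : ∀ i ∈ S, 0 < i := fun i hi => (Finset.mem_Icc.1 (h1 hi)).1
    rw [dif_pos ⟨hpos, h3⟩]
    simp only [Finset.mem_filter, Nat.Partition.distincts, Finset.mem_univ, true_and]
    exact ⟨S.nodup, h2, fun i hi => (Finset.mem_Icc.1 (h1 hi)).2⟩
  · intro p hp
    simp only [Finset.mem_filter, Nat.Partition.distincts, Finset.mem_univ, true_and] at hp
    obtain ⟨hnd, hc, hn⟩ := hp
    have hs : ∑ i ∈ p.parts.toFinset, i = l := by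
      have := p.parts_sum
      rw [Finset.sum, Multiset.toFinset_val, hnd.dedup]
      simpa using this
    have hpos : ∀ i ∈ p.parts.toFinset, 0 < i := fun i hi => p.parts_pos (Multiset.mem_toFinset.1 hi)
    rw [dif_pos ⟨hpos, hs⟩]
    ext1
    simp [hnd.dedup]
  · intro S hS
    simp only [Finset.mem_filter, Finset.mem_powerset] at hS
    obtain ⟨h1, h2, h3⟩ := hS
    have hpos : ∀ i ∈ S, 0 < i := fun i hi => (Finset.mem_Icc.1 (h1 hi)).1
    rw [dif_pos ⟨hpos, h3⟩]
    simp

theorem coeff_subsetSumPoly (a n l : ℕ) :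
    (subsetSumPoly a n).coeff l =
      ((((Finset.Icc 1 n).powersetCard a).filter (fun S => ∑ i ∈ S, i = l)).card : ℚ) := by
  unfold subsetSumPoly
  rw [Polynomial.finsetSum_coeff]
  simp only [Polynomial.coeff_X_pow]
  rw [Finset.sum_ite, Finset.sum_const_zero, add_zero, Finset.sum_const, nsmul_eq_mul, mul_one]
  congr 2
  ext S
  simp [eq_comm]

theorem map_rankGeneratingPoly (n b : ℕ) :
    (rankGeneratingPoly n b).map (Nat.castRingHom ℚ) =
      ∑ a ∈ Finset.range (b + 1), subsetSumPoly a n := by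
  ext l
  rw [Polynomial.coeff_map, coeff_rankGeneratingPoly, truncatedStaircaseCount_eq_card,
    Polynomial.finsetSum_coeff]
  simp only [coeff_subsetSumPoly]
  rw [← Nat.cast_sum, eq_natCast]
  congr 1
  rw [← Finset.card_biUnion]
  · congr 1
    ext S
    simp only [Finset.mem_filter, Finset.mem_powerset, Finset.mem_biUnion, Finset.mem_range,
      Finset.mem_powersetCard]
    constructor
    · rintro ⟨h1, h2, h3⟩
      exact ⟨S.card, by omega, ⟨h1, rfl⟩, h3⟩
    · rintro ⟨a, h1, ⟨h2, h3⟩, h4⟩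
      exact ⟨h2, by omega, h4⟩
  · intro x _ y _ hxy
    rw [Function.onFun, Finset.disjoint_left]
    intro S hS hS'
    simp only [Finset.mem_filter, Finset.mem_powersetCard] at hS hS'
    exact hxy (hS.1.2.symm.trans hS'.1.2)

@[simp] theorem subsetSumPoly_zero_left (n : ℕ) : subsetSumPoly 0 n = 1 := by
  simp [subsetSumPoly]

@[simp] theorem subsetSumPoly_succ_zero (a : ℕ) : subsetSumPoly (a + 1) 0 = 0 := by
  rw [subsetSumPoly, Finset.powersetCard_eq_empty.2 (by simp), Finset.sum_empty]

open Polynomial in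
theorem subsetSumPoly_succ_succ (a n : ℕ) :
    subsetSumPoly (a + 1) (n + 1) = subsetSumPoly (a + 1) n + X ^ (n + 1) * subsetSumPoly a n := by
  unfold subsetSumPoly
  have hI : Finset.Icc 1 (n + 1) = insert (n + 1) (Finset.Icc 1 n) := by
    ext i; simp only [Finset.mem_Icc, Finset.mem_insert]; omega
  have hn : n + 1 ∉ Finset.Icc 1 n := by simp
  rw [hI, Finset.powersetCard_succ_insert hn, Finset.sum_union, Finset.mul_sum, Finset.sum_image]
  · congr 1
    refine Finset.sum_congr rfl fun S hS => ?_
    have : n + 1 ∉ S := fun h => hn ((Finset.mem_powersetCard.1 hS).1 h)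
    rw [Finset.sum_insert this, pow_add]
  · intro S hS S' hS' h
    have h1 : n + 1 ∉ S := fun h => hn ((Finset.mem_powersetCard.1 hS).1 h)
    have h2 : n + 1 ∉ S' := fun h => hn ((Finset.mem_powersetCard.1 hS').1 h)
    rw [← Finset.erase_insert h1, ← Finset.erase_insert h2]
    exact congrArg (fun s => s.erase (n + 1)) h
  · rw [Finset.disjoint_left]
    intro S hS hS'
    obtain ⟨T, _, rfl⟩ := Finset.mem_image.1 hS'
    exact hn ((Finset.mem_powersetCard.1 hS).1 (Finset.mem_insert_self _ _))

open Polynomial in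
-- Combinatorially: lower every element by one, then drop 0 if it occurs. It complements
-- `subsetSumPoly_succ_succ`, which splits at the largest element instead of the smallest.
theorem subsetSumPoly_succ_succ' (a n : ℕ) :
    subsetSumPoly (a + 1) (n + 1) =
      X ^ (a + 1) * (subsetSumPoly (a + 1) n + subsetSumPoly a n) := by
  induction n generalizing a with
  | zero =>
    cases a with
    | zero => simp [subsetSumPoly_succ_succ]
    | succ a => simp [subsetSumPoly_succ_succ]
  | succ n ih =>
    cases a with
    | zero =>
      have h := subsetSumPoly_succ_succ 0 n
      rw [ih] at h
      rw [subsetSumPoly_succ_succ, ih]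
      simp only [subsetSumPoly_zero_left] at h ⊢
      linear_combination (-X) * h
    | succ a =>
      rw [subsetSumPoly_succ_succ (a + 1) (n + 1)]
      nth_rw 1 [ih (a + 1)]
      nth_rw 1 [ih a]
      rw [subsetSumPoly_succ_succ (a + 1) n, subsetSumPoly_succ_succ a n]
      ring

/-! ### Newton's identities -/

open Polynomial in
/-- Newton's identities for the polynomials `subsetSumPoly` and `powerSumPoly`. -/
theorem newton_subsetSumPoly (b n : ℕ) :
    (b : ℚ[X]) * subsetSumPoly b n =
      ∑ k ∈ Finset.Icc 1 b, (-1) ^ (k + 1) * (subsetSumPoly (b - k) n * powerSumPoly k n) := by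
  -- The identities for symmetric polynomials are evaluated at the `n` points `X ^ i`, `1 ≤ i ≤ n`.
  have hE : ∀ a, MvPolynomial.aeval (fun i : Finset.Icc 1 n => (X : ℚ[X]) ^ (i : ℕ))
      (MvPolynomial.esymm (Finset.Icc 1 n) ℚ a) = subsetSumPoly a n := by
    intro a
    rw [MvPolynomial.esymm, map_sum, subsetSumPoly]
    simp only [map_prod, MvPolynomial.aeval_X]
    have : Finset.Icc 1 n = (Finset.univ : Finset (Finset.Icc 1 n)).map
        (Function.Embedding.subtype _) := by
      ext i; simp
    conv_rhs => rw [this, Finset.powersetCard_map, Finset.sum_map]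
    refine Finset.sum_congr rfl fun S _ => ?_
    simp [Finset.mapEmbedding_apply, Finset.prod_pow_eq_pow_sum]
  have hP : ∀ k, MvPolynomial.aeval (fun i : Finset.Icc 1 n => (X : ℚ[X]) ^ (i : ℕ))
      (MvPolynomial.psum (Finset.Icc 1 n) ℚ k) = powerSumPoly k n := by
    intro k
    rw [MvPolynomial.psum, map_sum, powerSumPoly, ← Finset.sum_coe_sort (Finset.Icc 1 n)]
    refine Finset.sum_congr rfl fun i _ => ?_
    simp only [map_pow, MvPolynomial.aeval_X]
    rw [← pow_mul, mul_comm]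
  have h := congrArg (MvPolynomial.aeval (fun i : Finset.Icc 1 n => (X : ℚ[X]) ^ (i : ℕ)))
    (MvPolynomial.mul_esymm_eq_sum (Finset.Icc 1 n) ℚ b)
  simp only [map_mul, map_sum, map_pow, map_neg, map_one, map_natCast, hE, hP] at h
  rw [h, Finset.mul_sum]
  refine Finset.sum_nbij' (fun x => x.2) (fun k => (b - k, k)) ?_ ?_ ?_ ?_ ?_
  · rintro ⟨i, j⟩ hx
    simp only [Finset.mem_filter, Finset.HasAntidiagonal.mem_antidiagonal, Finset.mem_Icc] at hx ⊢; omega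
  · intro k hx
    simp only [Finset.mem_filter, Finset.HasAntidiagonal.mem_antidiagonal, Finset.mem_Icc] at hx ⊢; omega
  · rintro ⟨i, j⟩ hx
    simp only [Finset.mem_filter, Finset.HasAntidiagonal.mem_antidiagonal] at hx
    ext <;> simp; omega
  · intro k _; rfl
  · rintro ⟨i, j⟩ hx
    simp only [Finset.mem_filter, Finset.HasAntidiagonal.mem_antidiagonal] at hx
    obtain ⟨rfl, _⟩ := hx
    simp only [Nat.add_sub_cancel]
    have : (-1 : ℚ[X]) ^ (i + j + 1) * (-1) ^ i = (-1) ^ (j + 1) := by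
      rw [← pow_add, show i + j + 1 + i = 2 * i + (j + 1) by ring, pow_add, pow_mul]; simp
    rw [← this]; ring

/-! ### Gaussian binomials and the product formula -/

theorem gaussianBinomial_zero_right (n : ℕ) : gaussianBinomial n 0 = 1 := by
  simp [gaussianBinomial]

theorem one_sub_X_pow_ne_zero (a : ℕ) : (1 - RatFunc.X ^ (a + 1) : RatFunc ℚ) ≠ 0 := by
  have h : (1 - Polynomial.X ^ (a + 1) : Polynomial ℚ) ≠ 0 := by
    intro h
    have := congrArg (fun p => Polynomial.coeff p 0) h
    simp [Polynomial.coeff_X_pow] at this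
  intro h'
  apply h
  apply RatFunc.algebraMap_injective ℚ
  simpa [RatFunc.algebraMap_X] using h'

theorem prod_one_sub_X_pow_ne_zero (a : ℕ) :
    (∏ k ∈ Finset.Icc 1 a, (1 - RatFunc.X ^ k) : RatFunc ℚ) ≠ 0 := by
  rw [Finset.prod_ne_zero_iff]
  intro k hk
  obtain ⟨j, rfl⟩ : ∃ j, k = j + 1 := ⟨k - 1, by have := Finset.mem_Icc.1 hk; omega⟩
  exact one_sub_X_pow_ne_zero j

theorem gaussianBinomial_succ_right (n a : ℕ) :
    gaussianBinomial n (a + 1) * (1 - RatFunc.X ^ (a + 1)) =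
      gaussianBinomial n a * (1 - RatFunc.X ^ (n - a)) := by
  have h1 := one_sub_X_pow_ne_zero a
  have h2 := prod_one_sub_X_pow_ne_zero a
  unfold gaussianBinomial
  rw [Finset.prod_range_succ, Finset.prod_Icc_succ_top (by omega)]
  field_simp

theorem gaussianBinomial_succ_succ_mul (n a : ℕ) :
    gaussianBinomial (n + 1) (a + 1) * (1 - RatFunc.X ^ (a + 1)) =
      gaussianBinomial n a * (1 - RatFunc.X ^ (n + 1)) := by
  have h1 := one_sub_X_pow_ne_zero a
  have h2 := prod_one_sub_X_pow_ne_zero a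
  unfold gaussianBinomial
  rw [Finset.prod_range_succ', Finset.prod_Icc_succ_top (by omega)]
  simp only [Nat.add_sub_add_right, Nat.sub_zero]
  field_simp

theorem gaussianBinomial_eq_zero {n a : ℕ} (h : n < a) : gaussianBinomial n a = 0 := by
  unfold gaussianBinomial
  rw [Finset.prod_eq_zero (Finset.mem_range.2 h) (by simp), zero_div]

/-- After clearing the denominator this is 1 - X^(n+1) = (1 - X^(n-a)) + X^(n-a) (1 - X^(a+1)). -/
theorem gaussianBinomial_succ_succ {n a : ℕ} (h : a ≤ n) :
    gaussianBinomial (n + 1) (a + 1) =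
      gaussianBinomial n (a + 1) + RatFunc.X ^ (n - a) * gaussianBinomial n a := by
  have h1 := one_sub_X_pow_ne_zero a
  apply mul_right_cancel₀ h1
  rw [add_mul, gaussianBinomial_succ_succ_mul, gaussianBinomial_succ_right]
  have : (RatFunc.X : RatFunc ℚ) ^ (n + 1) = RatFunc.X ^ (n - a) * RatFunc.X ^ (a + 1) := by
    rw [← pow_add]; congr 1; omega
  rw [this]; ring

/-- Both sides satisfy the same recursion in `n`: the factor X^(n+1) contributed by the element `n +
1` splits as X^(n-a), the q-Pascal weight, times X^(a+1), the step between consecutive triangular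
exponents. -/
theorem algebraMap_subsetSumPoly (a n : ℕ) :
    algebraMap (Polynomial ℚ) (RatFunc ℚ) (subsetSumPoly a n) =
      RatFunc.X ^ (a * (a + 1) / 2) * gaussianBinomial n a := by
  induction n generalizing a with
  | zero =>
    cases a with
    | zero => simp [gaussianBinomial_zero_right]
    | succ a => simp [gaussianBinomial_eq_zero]
  | succ n ih =>
    cases a with
    | zero => simp [gaussianBinomial_zero_right]
    | succ a =>
      rw [subsetSumPoly_succ_succ, map_add, map_mul, ih, ih, map_pow, RatFunc.algebraMap_X]
      rcases Nat.lt_or_ge n a with h | h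
      · rw [gaussianBinomial_eq_zero h, gaussianBinomial_eq_zero (by omega : n < a + 1),
          gaussianBinomial_eq_zero (by omega : n + 1 < a + 1)]
        simp
      · have h1 : (a + 1) * (a + 1 + 1) / 2 = a * (a + 1) / 2 + (a + 1) := by
          have : (a + 1) * (a + 1 + 1) = a * (a + 1) + (a + 1) * 2 := by ring
          rw [this, Nat.add_mul_div_right _ _ (by norm_num)]
        have h2 : (RatFunc.X : RatFunc ℚ) ^ (n + 1) = RatFunc.X ^ (n - a) * RatFunc.X ^ (a + 1) := by
          rw [← pow_add]; congr 1; omega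
        rw [gaussianBinomial_succ_succ h, h1, h2, pow_add]
        ring

theorem algebraMap_rankGeneratingPoly (n b : ℕ) :
    algebraMap (Polynomial ℚ) (RatFunc ℚ)
          ((rankGeneratingPoly n b).map (Nat.castRingHom ℚ)) =
        ∑ a ∈ Finset.range (b + 1),
          RatFunc.X ^ (a * (a + 1) / 2) * gaussianBinomial n a := by
  rw [map_rankGeneratingPoly, map_sum]
  exact Finset.sum_congr rfl fun a _ => algebraMap_subsetSumPoly a n

/-! ### Coefficients at integer exponents; the two outer ranges -/

/-- The coefficient of a polynomial at an integer exponent, zero at negative exponents. -/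
noncomputable def zcoeff (l : ℤ) : Polynomial ℚ →ₗ[ℚ] ℚ :=
  if 0 ≤ l then Polynomial.lcoeff ℚ l.toNat else 0

theorem zcoeff_natCast (l : ℕ) (p : Polynomial ℚ) : zcoeff l p = p.coeff l := by
  simp [zcoeff]

theorem zcoeff_of_neg {l : ℤ} (h : l < 0) (p : Polynomial ℚ) : zcoeff l p = 0 := by
  simp [zcoeff, not_le.2 h]

theorem zcoeff_X_pow_mul (k : ℕ) (l : ℤ) (p : Polynomial ℚ) :
    zcoeff l (Polynomial.X ^ k * p) = zcoeff (l - k) p := by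
  rcases lt_or_ge l 0 with h | h
  · rw [zcoeff_of_neg h, zcoeff_of_neg (by omega)]
  lift l to ℕ using h
  rw [zcoeff_natCast, Polynomial.coeff_X_pow_mul']
  split_ifs with hk
  · rw [← Nat.cast_sub hk, zcoeff_natCast]
  · rw [zcoeff_of_neg (by omega)]

theorem zcoeff_one (l : ℤ) : zcoeff l 1 = if l = 0 then 1 else 0 := by
  rcases lt_or_ge l 0 with h | h
  · rw [zcoeff_of_neg h, if_neg (by omega)]
  lift l to ℕ using h
  rw [zcoeff_natCast, Polynomial.coeff_one]
  simp

theorem zcoeff_X_pow (k : ℕ) (l : ℤ) :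
    zcoeff l (Polynomial.X ^ k) = if l = k then 1 else 0 := by
  rw [← mul_one (Polynomial.X ^ k), zcoeff_X_pow_mul, zcoeff_one]
  simp [sub_eq_zero]

theorem zcoeff_X_mul (l : ℤ) (p : Polynomial ℚ) :
    zcoeff l (Polynomial.X * p) = zcoeff (l - 1) p := by
  simpa using zcoeff_X_pow_mul 1 l p

theorem zcoeff_one_sub_X_mul (l : ℤ) (p : Polynomial ℚ) :
    zcoeff l ((1 - Polynomial.X) * p) = zcoeff l p - zcoeff (l - 1) p := by
  rw [sub_mul, one_mul, map_sub, zcoeff_X_mul]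

theorem zcoeff_subsetSumPoly_nonneg (a n : ℕ) (l : ℤ) : 0 ≤ zcoeff l (subsetSumPoly a n) := by
  rcases lt_or_ge l 0 with h | h
  · rw [zcoeff_of_neg h]
  lift l to ℕ using h
  rw [zcoeff_natCast, coeff_subsetSumPoly]
  positivity

theorem zcoeff_subsetSumPoly_eq_zero {a n : ℕ} {l : ℤ} (h : a * n < l) :
    zcoeff l (subsetSumPoly a n) = 0 := by
  lift l to ℕ using by nlinarith
  rw [zcoeff_natCast, coeff_subsetSumPoly, Nat.cast_eq_zero, Finset.card_eq_zero,
    Finset.filter_eq_empty_iff]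
  intro S hS hl
  rw [Finset.mem_powersetCard] at hS
  have := Finset.sum_le_card_nsmul S (fun i => i) n fun i hi => (Finset.mem_Icc.1 (hS.1 hi)).2
  rw [hS.2, hl, smul_eq_mul] at this
  norm_cast at h
  omega

/-- This is the reflection `i ↦ n + 1 - i`. It exchanges smallest and largest element, so the
induction expands one side by each of the two recursions. -/
theorem zcoeff_subsetSumPoly_symm (a n : ℕ) (l : ℤ) :
    zcoeff (a * (n + 1) - l) (subsetSumPoly a n) = zcoeff l (subsetSumPoly a n) := by
  induction n generalizing a l with
  | zero =>
    cases a with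
    | zero => simp [zcoeff_one]
    | succ a => simp
  | succ n ih =>
    cases a with
    | zero => simp [zcoeff_one]
    | succ a =>
      conv_rhs => rw [subsetSumPoly_succ_succ']
      rw [subsetSumPoly_succ_succ, map_add, zcoeff_X_pow_mul, zcoeff_X_pow_mul, map_add,
        ← ih (a + 1), ← ih a]
      congr 2 <;> congr 1 <;> push_cast <;> ring

theorem zcoeff_subsetSumPoly_one (n : ℕ) (l : ℤ) :
    zcoeff l (subsetSumPoly 1 n) = if 1 ≤ l ∧ l ≤ n then 1 else 0 := by
  induction n with
  | zero => rw [if_neg (by omega)]; simp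
  | succ n ih =>
    rw [subsetSumPoly_succ_succ, map_add, ih, subsetSumPoly_zero_left, mul_one, zcoeff_X_pow]
    split_ifs <;> first | omega | norm_num

/-- For `a ≥ 2`, removing the smallest possible element lowers `n` by one but the exponent by `a`,
so the hypothesis `l < n` survives the induction, and both polynomials that appear still have index
at least 1. -/
theorem zcoeff_subsetSumPoly_le_succ {a n : ℕ} {l : ℤ} (ha : 1 ≤ a) (h : l < n) :
    zcoeff l (subsetSumPoly a n) ≤ zcoeff (l + 1) (subsetSumPoly a n) := by
  rcases lt_or_ge l 0 with hl | hl
  · rw [zcoeff_of_neg hl]; exact zcoeff_subsetSumPoly_nonneg _ _ _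
  induction n generalizing a l with
  | zero => omega
  | succ n ih =>
    obtain ⟨a, rfl⟩ : ∃ a', a = a' + 1 := ⟨a - 1, by omega⟩
    cases a with
    | zero =>
      rw [zcoeff_subsetSumPoly_one, zcoeff_subsetSumPoly_one]
      split_ifs <;> first | omega | norm_num
    | succ a =>
      rw [subsetSumPoly_succ_succ', zcoeff_X_pow_mul, zcoeff_X_pow_mul, map_add, map_add,
        show l + 1 - ((a + 1 + 1 : ℕ) : ℤ) = l - ((a + 1 + 1 : ℕ) : ℤ) + 1 by ring]
      have key : ∀ a' : ℕ, 1 ≤ a' → zcoeff (l - ((a + 1 + 1 : ℕ) : ℤ)) (subsetSumPoly a' n) ≤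
          zcoeff (l - ((a + 1 + 1 : ℕ) : ℤ) + 1) (subsetSumPoly a' n) := by
        intro a' ha'
        rcases lt_or_ge (l - ((a + 1 + 1 : ℕ) : ℤ)) 0 with hl' | hl'
        · rw [zcoeff_of_neg hl']; exact zcoeff_subsetSumPoly_nonneg _ _ _
        · exact ih ha' (by push_cast at h ⊢; omega) hl'
      exact add_le_add (key _ (by omega)) (key _ (by omega))

/-- The coefficients of the sum of the polynomials `subsetSumPoly a n` for `a ≤ b`. -/
noncomputable def truncatedCoeff (b n : ℕ) (l : ℤ) : ℚ :=
  ∑ a ∈ Finset.range (b + 1), zcoeff l (subsetSumPoly a n)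

theorem cast_coeff_rankGeneratingPoly (n b l : ℕ) :
    ((rankGeneratingPoly n b).coeff l : ℚ) = truncatedCoeff b n l := by
  have h := congrArg (fun p => Polynomial.coeff p l) (map_rankGeneratingPoly n b)
  simp only [Polynomial.coeff_map, Polynomial.finsetSum_coeff, eq_natCast] at h
  rw [h, truncatedCoeff]
  simp only [zcoeff_natCast]

/-- The only loss comes from the empty set at `l = 0`, and the singleton {1} compensates for it. -/
theorem truncatedCoeff_le_succ {b n : ℕ} {l : ℤ} (hb : 1 ≤ b) (hl : 0 ≤ l) (h : l < n) :
    truncatedCoeff b n l ≤ truncatedCoeff b n (l + 1) := by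
  obtain ⟨b, rfl⟩ : ∃ b', b = b' + 1 := ⟨b - 1, by omega⟩
  unfold truncatedCoeff
  rw [Finset.sum_range_succ', Finset.sum_range_succ', Finset.sum_range_succ',
    Finset.sum_range_succ', add_assoc, add_assoc]
  refine add_le_add (Finset.sum_le_sum fun a _ => zcoeff_subsetSumPoly_le_succ (by omega) h) ?_
  simp only [zero_add, zcoeff_subsetSumPoly_one, subsetSumPoly_zero_left, zcoeff_one]
  split_ifs <;> first | omega | norm_num

/-- Sets with fewer than `b` elements have too small a sum, so only one symmetric polynomial
contributes. The bound on `l` says exactly that the reflected exponent `b * (n + 1) - (l + 1)` is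
below `n`. -/
theorem truncatedCoeff_succ_le {b n : ℕ} {l : ℤ} (hb : 1 ≤ b) (h : (b - 1) * (n + 1) < l) :
    truncatedCoeff b n (l + 1) ≤ truncatedCoeff b n l := by
  have hs : ∀ l' : ℤ, l ≤ l' → truncatedCoeff b n l' = zcoeff l' (subsetSumPoly b n) := by
    intro l' hl'
    unfold truncatedCoeff
    rw [Finset.sum_range_succ, Finset.sum_eq_zero, zero_add]
    intro a ha
    apply zcoeff_subsetSumPoly_eq_zero
    have h1 : (a : ℤ) ≤ b - 1 := by have := Finset.mem_range.1 ha; omega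
    nlinarith
  rw [hs _ le_rfl, hs _ (by omega), ← zcoeff_subsetSumPoly_symm, ← zcoeff_subsetSumPoly_symm b n l,
    show (b : ℤ) * (n + 1) - l = b * (n + 1) - (l + 1) + 1 by ring]
  apply zcoeff_subsetSumPoly_le_succ hb
  nlinarith

/-! ### Reduction to the middle range -/

theorem isUnimodalPoly_of_peak {b n : ℕ} (hb : 1 ≤ b) (k : ℕ)
    (h1 : ∀ l : ℤ, n ≤ l → l < k → truncatedCoeff b n l ≤ truncatedCoeff b n (l + 1))
    (h2 : ∀ l : ℤ, k ≤ l → l ≤ (b - 1) * (n + 1) →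
      truncatedCoeff b n (l + 1) ≤ truncatedCoeff b n l) :
    IsUnimodalPoly (rankGeneratingPoly n b) := by
  refine ⟨k, ?_, ?_⟩
  · apply monotoneOn_of_le_succ Set.ordConnected_Iic
    intro l _ _ hl
    rw [Nat.succ_eq_succ, Set.mem_Iic] at hl
    rw [Nat.succ_eq_succ, ← Nat.cast_le (α := ℚ), cast_coeff_rankGeneratingPoly,
      cast_coeff_rankGeneratingPoly, Nat.cast_succ]
    rcases lt_or_ge l n with h | h
    · exact truncatedCoeff_le_succ hb (by omega) (by omega)
    · exact h1 l (by omega) (by omega)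
  · apply antitoneOn_of_succ_le Set.ordConnected_Ici
    intro l _ hl _
    rw [Set.mem_Ici] at hl
    rw [Nat.succ_eq_succ, ← Nat.cast_le (α := ℚ), cast_coeff_rankGeneratingPoly,
      cast_coeff_rankGeneratingPoly, Nat.cast_succ]
    rcases lt_or_ge (((b : ℤ) - 1) * (n + 1)) (l : ℤ) with h | h
    · exact truncatedCoeff_succ_le hb h
    · exact h2 l (by omega) h

theorem isUnimodalPoly_of_no_valley {b n : ℕ} (hb : 1 ≤ b)
    (h : ∀ l l' : ℤ, n ≤ l → l < l' → l' ≤ (b - 1) * (n + 1) →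
      truncatedCoeff b n (l + 1) < truncatedCoeff b n l →
      truncatedCoeff b n (l' + 1) ≤ truncatedCoeff b n l') :
    IsUnimodalPoly (rankGeneratingPoly n b) := by
  classical
  -- The peak is the first `k ≥ n` that has left the middle range or is followed by a strict
  -- descent.
  have hex : ∃ k : ℕ, n ≤ k ∧ ((b - 1) * (n + 1) < (k : ℤ) ∨
      truncatedCoeff b n (k + 1) < truncatedCoeff b n k) :=
    ⟨b * (n + 1), by nlinarith, Or.inl (by push_cast; nlinarith)⟩
  refine isUnimodalPoly_of_peak hb (Nat.find hex) ?_ ?_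
  · intro l hnl hl
    lift l to ℕ using by omega
    have := Nat.find_min hex (m := l) (by omega)
    simp only [not_and, not_or, not_lt] at this
    exact (this (by omega)).2
  · intro l hl hlM
    obtain ⟨h1, h2⟩ := Nat.find_spec hex
    rcases h2 with h2 | h2
    · omega
    · rcases hl.eq_or_lt with rfl | hl
      · exact h2.le
      · exact h _ l (by omega) hl hlM h2

/-! ### Closed forms for products of power sums -/

open Polynomial in
theorem one_sub_X_pow_mul_powerSumPoly (k n : ℕ) :
    (1 - X ^ k) * powerSumPoly k n = X ^ k * (1 - X ^ (k * n)) := by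
  induction n with
  | zero => simp [powerSumPoly]
  | succ n ih =>
    have : powerSumPoly k (n + 1) = powerSumPoly k n + X ^ (k * (n + 1)) := by
      unfold powerSumPoly
      rw [Finset.sum_Icc_succ_top (by omega)]
    rw [this, mul_add, ih]
    ring

theorem zcoeff_powerSumPoly_mul (k n : ℕ) (u : Polynomial ℚ) (l : ℤ) :
    zcoeff l (powerSumPoly k n * u) =
      zcoeff (l - k) (powerSumPoly k n * u) + zcoeff (l - k) u - zcoeff (l - k - k * n) u := by
  have h := congrArg (fun p => zcoeff l (p * u)) (one_sub_X_pow_mul_powerSumPoly k n)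
  simp only [sub_mul, one_mul, mul_sub, mul_one, mul_assoc, map_sub, zcoeff_X_pow_mul] at h
  push_cast at h
  linarith

theorem zcoeff_powerSumPoly_one_mul_succ (n : ℕ) (u : Polynomial ℚ) (l : ℤ) :
    zcoeff (l + 1) (powerSumPoly 1 n * u) - zcoeff l (powerSumPoly 1 n * u) =
      zcoeff l u - zcoeff (l - n) u := by
  rw [zcoeff_powerSumPoly_mul 1 n u (l + 1)]
  simp only [Nat.cast_one, one_mul, add_sub_cancel_right]
  ring

/-- A solution of the recurrence for the coefficients of `powerSumPoly k n * u` which vanishes at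
negative exponents gives the coefficients. -/
theorem zcoeff_powerSumPoly_mul_eq {k n : ℕ} (hk : 0 < k) {u : Polynomial ℚ} {g f : ℤ → ℤ}
    (hu : ∀ l, zcoeff l u = g l) (h0 : ∀ l < 0, f l = 0)
    (hs : ∀ l, f l = f (l - k) + g (l - k) - g (l - k - k * n)) (l : ℤ) :
    zcoeff l (powerSumPoly k n * u) = f l := by
  have main : ∀ m : ℕ, ∀ l : ℤ, l < m → zcoeff l (powerSumPoly k n * u) = f l := by
    intro m
    induction m with
    | zero =>
      intro l hl
      rw [zcoeff_of_neg (by simpa using hl), h0 l (by simpa using hl), Int.cast_zero]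
    | succ m ih =>
      intro l hl
      rw [zcoeff_powerSumPoly_mul, ih (l - k) (by push_cast at hl; omega), hu, hu, hs l]
      push_cast
      ring
  exact main (l.toNat + 1) l (by omega)

/-- The coefficients of `powerSumPoly k n`. -/
def powerSumCoeff (k n : ℕ) (l : ℤ) : ℤ :=
  max 0 (min (l / k) n) - max 0 (min ((l - 1) / k) n)

/-- The difference of the floors of l/k and (l-1)/k detects the multiples of `k`; the clamps keep
those with quotient from 1 to `n`. The bound `k ≤ 4` makes the divisors literals, as `omega`
requires. -/
theorem zcoeff_powerSumPoly {k n : ℕ} (h1 : 1 ≤ k) (h4 : k ≤ 4) (l : ℤ) :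
    zcoeff l (powerSumPoly k n) = powerSumCoeff k n l := by
  induction n with
  | zero =>
    have : powerSumCoeff k 0 l = 0 := by unfold powerSumCoeff; omega
    simp [this, powerSumPoly]
  | succ n ih =>
    have : powerSumPoly k (n + 1) = powerSumPoly k n + Polynomial.X ^ (k * (n + 1)) := by
      unfold powerSumPoly
      rw [Finset.sum_Icc_succ_top (by omega)]
    rw [this, map_add, ih, zcoeff_X_pow]
    have h : powerSumCoeff k (n + 1) l =
        powerSumCoeff k n l + if l = (k * (n + 1) : ℕ) then 1 else 0 := by
      unfold powerSumCoeff
      interval_cases k <;> split_ifs <;> omega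
    rw [h]
    push_cast
    rfl

/-- The coefficients of `powerSumPoly 1 n * powerSumPoly 1 n`. -/
def tentCoeff (n : ℕ) (l : ℤ) : ℤ := max 0 (min (l - 1) (2 * n + 1 - l))

theorem zcoeff_powerSumPoly_one_mul_one (n : ℕ) (l : ℤ) :
    zcoeff l (powerSumPoly 1 n * powerSumPoly 1 n) = tentCoeff n l := by
  refine zcoeff_powerSumPoly_mul_eq one_pos
    (fun l => zcoeff_powerSumPoly le_rfl (by norm_num) l) ?_ ?_ l
  · intro l hl
    unfold tentCoeff
    omega
  · intro l
    unfold tentCoeff powerSumCoeff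
    simp only [Nat.cast_one, Int.ediv_one, one_mul]
    rcases le_or_gt l (n + 1) with h | h <;> rcases le_or_gt (l - 1 - n) 0 with h' | h' <;> omega

/-- The coefficients of `powerSumPoly 1 n * powerSumPoly 2 n`. -/
def oneTwoCoeff (n : ℕ) (l : ℤ) : ℤ :=
  max 0 (min (n : ℤ) ((l - 1) / 2) - max 1 ((l - n + 1) / 2) + 1)

/-- For l = i + 2j the constraints on `i` and `j` confine `j` to an interval, whose length is the
closed form. -/
theorem zcoeff_powerSumPoly_one_mul_two (n : ℕ) (l : ℤ) :
    zcoeff l (powerSumPoly 1 n * powerSumPoly 2 n) = oneTwoCoeff n l := by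
  refine zcoeff_powerSumPoly_mul_eq one_pos
    (fun l => zcoeff_powerSumPoly (by norm_num) (by norm_num) l) ?_ ?_ l
  · intro l hl
    unfold oneTwoCoeff
    omega
  · intro l
    unfold oneTwoCoeff powerSumCoeff
    push_cast
    have h1 : (l - 1 - n) / 2 = (l - n + 1) / 2 - 1 := by omega
    have h2 : (l - 1 - 1 * n) / 2 = (l - n + 1) / 2 - 1 := by omega
    have h3 : (l - 1 - 1 * n - 1) / 2 = (l - 1 - n + 1) / 2 - 1 := by omega
    have h4 : (l - 1 - 1) / 2 = (l - 2) / 2 := by omega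
    have h5 : (l - 1 - n + 1) / 2 = (l - n) / 2 := by omega
    rw [h3, h2, h4, h5]
    have h6 : (l - 1) / 2 - (l - 2) / 2 = if l % 2 = 1 then 1 else 0 := by split_ifs <;> omega
    have h7 : (l - n + 1) / 2 + (l - 1) / 2 - ((l - n) / 2 + (l - 2) / 2) ≤ 2 := by omega
    have h8 : 0 ≤ (l - n + 1) / 2 - (l - n) / 2 := by omega
    have h9 : (l - n + 1) / 2 - (l - n) / 2 ≤ 1 := by omega
    have h10 : (l - n) / 2 ≤ (l - 1) / 2 + 1 := by omega
    have h11 : (l - n + 1) / 2 ≤ (l - 1) / 2 + 1 := by omega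
    have h12 : (l - n) / 2 ≤ (l - 2) / 2 + 1 := by omega
    have h13 : (l - n + 1) / 2 ≤ (l - 2) / 2 + 1 ∨ n = 0 := by omega
    -- The floors become unknowns constrained only by the inequalities collected above.
    generalize (l - n + 1) / 2 = p at *
    generalize (l - n) / 2 = q at *
    generalize (l - 1) / 2 = a at *
    generalize (l - 2) / 2 = a' at *
    clear h1 h2 h3 h4 h5
    split_ifs at h6 <;> omega

/-- The coefficients of `powerSumPoly 2 n * powerSumPoly 2 n`. -/
def twoTwoCoeff (n : ℕ) (l : ℤ) : ℤ := if l % 2 = 0 then tentCoeff n (l / 2) else 0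

theorem zcoeff_powerSumPoly_two_mul_two (n : ℕ) (l : ℤ) :
    zcoeff l (powerSumPoly 2 n * powerSumPoly 2 n) = twoTwoCoeff n l := by
  refine zcoeff_powerSumPoly_mul_eq two_pos
    (fun l => zcoeff_powerSumPoly (by norm_num) (by norm_num) l) ?_ ?_ l
  · intro l hl
    unfold twoTwoCoeff tentCoeff
    omega
  · intro l
    unfold twoTwoCoeff tentCoeff powerSumCoeff
    push_cast
    obtain ⟨m, rfl | rfl⟩ := Int.even_or_odd' l
    · rw [if_pos (by omega), if_pos (by omega), show 2 * m / 2 = m by omega,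
        show (2 * m - 2) / 2 = m - 1 by omega, show (2 * m - 2 - 1) / 2 = m - 2 by omega,
        show (2 * m - 2 - 2 * (n : ℤ)) / 2 = m - 1 - n by omega,
        show (2 * m - 2 - 2 * (n : ℤ) - 1) / 2 = m - 2 - n by omega]
      omega
    · rw [if_neg (by omega), if_neg (by omega), show (2 * m + 1 - 2) / 2 = m - 1 by omega,
        show (2 * m + 1 - 2 - 1) / 2 = m - 1 by omega,
        show (2 * m + 1 - 2 - 2 * (n : ℤ)) / 2 = m - 1 - n by omega,
        show (2 * m + 1 - 2 - 2 * (n : ℤ) - 1) / 2 = m - 1 - n by omega]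
      omega

/-- The binomial coefficient `x.choose 2`, extended by zero to negative integers. -/
def choosePlus (x : ℤ) : ℤ := (x.toNat.choose 2 : ℕ)

theorem choosePlus_of_nonpos {x : ℤ} (h : x ≤ 0) : choosePlus x = 0 := by
  simp [choosePlus, Int.toNat_of_nonpos h]

theorem two_mul_choosePlus {x : ℤ} (h : 0 ≤ x) : 2 * choosePlus x = x * (x - 1) := by
  lift x to ℕ using h
  rw [choosePlus, Int.toNat_natCast]
  induction x with
  | zero => simp
  | succ x ih =>
    rw [Nat.choose_succ_succ, Nat.choose_one_right]
    push_cast at ih ⊢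
    linarith

theorem choosePlus_sub (x : ℤ) : choosePlus x - choosePlus (x - 1) = max 0 (x - 1) := by
  rcases le_or_gt x 0 with h | h
  · rw [choosePlus_of_nonpos h, choosePlus_of_nonpos (by omega)]; omega
  · have h1 := two_mul_choosePlus h.le
    have h2 := two_mul_choosePlus (x := x - 1) (by omega)
    rw [max_eq_right (by omega)]
    linarith

/-- The coefficients of the cube of `powerSumPoly 1 n`. -/
def cubeCoeff (n : ℕ) (l : ℤ) : ℤ :=
  choosePlus (l - 1) - 3 * choosePlus (l - 1 - n) + 3 * choosePlus (l - 1 - 2 * n) -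
    choosePlus (l - 1 - 3 * n)

/-- The closed form expands X³ (1 - Xⁿ)³ / (1 - X)³. -/
theorem zcoeff_powerSumPoly_one_cube (n : ℕ) (l : ℤ) :
    zcoeff l (powerSumPoly 1 n * (powerSumPoly 1 n * powerSumPoly 1 n)) = cubeCoeff n l := by
  refine zcoeff_powerSumPoly_mul_eq one_pos (zcoeff_powerSumPoly_one_mul_one n) ?_ ?_ l
  · intro l hl
    unfold cubeCoeff
    rw [choosePlus_of_nonpos, choosePlus_of_nonpos, choosePlus_of_nonpos, choosePlus_of_nonpos] <;> omega
  · intro l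
    unfold cubeCoeff tentCoeff
    have h1 := choosePlus_sub (l - 1)
    have h2 := choosePlus_sub (l - 1 - n)
    have h3 := choosePlus_sub (l - 1 - 2 * n)
    have h4 := choosePlus_sub (l - 1 - 3 * n)
    rw [show l - 1 - n - 1 = l - 1 - 1 - n by ring] at h2
    rw [show l - 1 - 2 * n - 1 = l - 1 - 1 - 2 * n by ring] at h3
    rw [show l - 1 - 3 * n - 1 = l - 1 - 1 - 3 * n by ring] at h4
    push_cast
    omega

/-! ### Power sum expansions for at most four parts, and their differences -/

theorem subsetSumPoly_one (n : ℕ) : subsetSumPoly 1 n = powerSumPoly 1 n := by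
  have h := newton_subsetSumPoly 1 n
  simpa using h

theorem two_mul_subsetSumPoly_two (n : ℕ) :
    ((2 : ℕ) : Polynomial ℚ) * subsetSumPoly 2 n =
      powerSumPoly 1 n * powerSumPoly 1 n - powerSumPoly 2 n := by
  have h := newton_subsetSumPoly 2 n
  simp only [Finset.sum_Icc_succ_top (show 1 ≤ 1 + 1 by omega), Finset.Icc_self,
    Finset.sum_singleton] at h
  norm_num [subsetSumPoly_one] at h ⊢
  linear_combination h

theorem six_mul_subsetSumPoly_three (n : ℕ) :
    ((6 : ℕ) : Polynomial ℚ) * subsetSumPoly 3 n =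
      powerSumPoly 1 n * (powerSumPoly 1 n * powerSumPoly 1 n) -
        ((3 : ℕ) : Polynomial ℚ) * (powerSumPoly 1 n * powerSumPoly 2 n) +
        ((2 : ℕ) : Polynomial ℚ) * powerSumPoly 3 n := by
  have h := newton_subsetSumPoly 3 n
  have h2 := two_mul_subsetSumPoly_two n
  rw [Finset.sum_Icc_succ_top (by omega), Finset.sum_Icc_succ_top (by omega)] at h
  norm_num [subsetSumPoly_one] at h h2 ⊢
  linear_combination 2 * h + powerSumPoly 1 n * h2

theorem twentyfour_mul_subsetSumPoly_four (n : ℕ) :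
    ((24 : ℕ) : Polynomial ℚ) * subsetSumPoly 4 n =
      powerSumPoly 1 n * (powerSumPoly 1 n * (powerSumPoly 1 n * powerSumPoly 1 n)) -
        ((6 : ℕ) : Polynomial ℚ) * (powerSumPoly 1 n * (powerSumPoly 1 n * powerSumPoly 2 n)) +
        ((3 : ℕ) : Polynomial ℚ) * (powerSumPoly 2 n * powerSumPoly 2 n) +
        ((8 : ℕ) : Polynomial ℚ) * (powerSumPoly 1 n * powerSumPoly 3 n) -
        ((6 : ℕ) : Polynomial ℚ) * powerSumPoly 4 n := by
  have h := newton_subsetSumPoly 4 n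
  have h2 := two_mul_subsetSumPoly_two n
  have h3 := six_mul_subsetSumPoly_three n
  rw [Finset.sum_Icc_succ_top (by omega), Finset.sum_Icc_succ_top (by omega),
    Finset.sum_Icc_succ_top (by omega)] at h
  norm_num [subsetSumPoly_one] at h h2 h3 ⊢
  linear_combination 6 * h + powerSumPoly 1 n * h3 - 3 * powerSumPoly 2 n * h2

/-- The difference `zcoeff (l + 1) p - zcoeff l p`. -/
noncomputable def zdiff (l : ℤ) : Polynomial ℚ →ₗ[ℚ] ℚ := zcoeff (l + 1) - zcoeff l

theorem zdiff_apply (l : ℤ) (p : Polynomial ℚ) :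
    zdiff l p = zcoeff (l + 1) p - zcoeff l p := rfl

theorem zdiff_natCast_mul (k : ℕ) (l : ℤ) (p : Polynomial ℚ) :
    zdiff l ((k : Polynomial ℚ) * p) = k * zdiff l p := by
  rw [← nsmul_eq_mul, map_nsmul, nsmul_eq_mul]

theorem zdiff_powerSumPoly_one_mul (n : ℕ) (u : Polynomial ℚ) (l : ℤ) :
    zdiff l (powerSumPoly 1 n * u) = zcoeff l u - zcoeff (l - n) u :=
  zcoeff_powerSumPoly_one_mul_succ n u l

theorem zdiff_subsetSumPoly_one (n : ℕ) (l : ℤ) :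
    zdiff l (subsetSumPoly 1 n) = powerSumCoeff 1 n (l + 1) - powerSumCoeff 1 n l := by
  rw [subsetSumPoly_one, zdiff_apply, zcoeff_powerSumPoly, zcoeff_powerSumPoly] <;> norm_num

theorem two_mul_zdiff_subsetSumPoly_two (n : ℕ) (l : ℤ) :
    2 * zdiff l (subsetSumPoly 2 n) = ((powerSumCoeff 1 n l - powerSumCoeff 1 n (l - n) -
      (powerSumCoeff 2 n (l + 1) - powerSumCoeff 2 n l) : ℤ) : ℚ) := by
  have h := congrArg (zdiff l) (two_mul_subsetSumPoly_two n)
  rw [zdiff_natCast_mul, map_sub, zdiff_powerSumPoly_one_mul, zdiff_apply l (powerSumPoly 2 n),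
    zcoeff_powerSumPoly (by norm_num) (by norm_num), zcoeff_powerSumPoly (by norm_num) (by norm_num),
    zcoeff_powerSumPoly (by norm_num) (by norm_num),
    zcoeff_powerSumPoly (by norm_num) (by norm_num)] at h
  push_cast at h ⊢
  linarith

theorem six_mul_zdiff_subsetSumPoly_three (n : ℕ) (l : ℤ) :
    6 * zdiff l (subsetSumPoly 3 n) = ((tentCoeff n l - tentCoeff n (l - n) -
      3 * (powerSumCoeff 2 n l - powerSumCoeff 2 n (l - n)) +
      2 * (powerSumCoeff 3 n (l + 1) - powerSumCoeff 3 n l) : ℤ) : ℚ) := by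
  have h := congrArg (zdiff l) (six_mul_subsetSumPoly_three n)
  rw [zdiff_natCast_mul, map_add, map_sub, zdiff_natCast_mul, zdiff_natCast_mul,
    zdiff_powerSumPoly_one_mul, zdiff_powerSumPoly_one_mul, zdiff_apply l (powerSumPoly 3 n),
    zcoeff_powerSumPoly_one_mul_one, zcoeff_powerSumPoly_one_mul_one,
    zcoeff_powerSumPoly (by norm_num) (by norm_num), zcoeff_powerSumPoly (by norm_num) (by norm_num),
    zcoeff_powerSumPoly (by norm_num) (by norm_num),
    zcoeff_powerSumPoly (by norm_num) (by norm_num)] at h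
  push_cast at h ⊢
  linarith

theorem twentyfour_mul_zdiff_subsetSumPoly_four (n : ℕ) (l : ℤ) :
    24 * zdiff l (subsetSumPoly 4 n) = ((cubeCoeff n l - cubeCoeff n (l - n) -
      6 * (oneTwoCoeff n l - oneTwoCoeff n (l - n)) +
      3 * (twoTwoCoeff n (l + 1) - twoTwoCoeff n l) +
      8 * (powerSumCoeff 3 n l - powerSumCoeff 3 n (l - n)) -
      6 * (powerSumCoeff 4 n (l + 1) - powerSumCoeff 4 n l) : ℤ) : ℚ) := by
  have h := congrArg (zdiff l) (twentyfour_mul_subsetSumPoly_four n)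
  rw [zdiff_natCast_mul, map_sub, map_add, map_add, map_sub, zdiff_natCast_mul, zdiff_natCast_mul,
    zdiff_natCast_mul, zdiff_natCast_mul, zdiff_powerSumPoly_one_mul, zdiff_powerSumPoly_one_mul,
    zdiff_powerSumPoly_one_mul, zdiff_apply l (powerSumPoly 4 n),
    zdiff_apply l (powerSumPoly 2 n * _),
    zcoeff_powerSumPoly_one_cube, zcoeff_powerSumPoly_one_cube,
    zcoeff_powerSumPoly_one_mul_two, zcoeff_powerSumPoly_one_mul_two,
    zcoeff_powerSumPoly_two_mul_two, zcoeff_powerSumPoly_two_mul_two,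
    zcoeff_powerSumPoly (by norm_num) (by norm_num), zcoeff_powerSumPoly (by norm_num) (by norm_num),
    zcoeff_powerSumPoly (by norm_num) (by norm_num),
    zcoeff_powerSumPoly (by norm_num) (by norm_num)] at h
  push_cast at h ⊢
  linarith

/-! ### Unimodality for `b ≤ 3` -/

theorem isUnimodalPoly_rankGeneratingPoly_zero (n : ℕ) :
    IsUnimodalPoly (rankGeneratingPoly n 0) := by
  have h : ∀ l : ℕ, 0 < l → (rankGeneratingPoly n 0).coeff l = 0 := by
    intro l hl
    rw [coeff_rankGeneratingPoly]
    exact truncatedStaircaseCount_eq_zero (by omega)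
  refine ⟨0, ?_, ?_⟩
  · intro x hx y hy _
    rw [Set.mem_Iic] at hx hy
    simp [Nat.le_zero.1 hx, Nat.le_zero.1 hy]
  · intro x _ y _ hxy
    rcases hxy.eq_or_lt with rfl | hxy
    · exact le_rfl
    · simp only [h y (by omega)]
      exact Nat.zero_le _

theorem zdiff_subsetSumPoly_zero {n : ℕ} {l : ℤ} (hl : 1 ≤ l) :
    zdiff l (subsetSumPoly 0 n) = 0 := by
  rw [zdiff_apply, subsetSumPoly_zero_left, zcoeff_one, zcoeff_one, if_neg (by omega),
    if_neg (by omega), sub_zero]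

theorem truncatedCoeff_sub (b n : ℕ) (l : ℤ) :
    truncatedCoeff b n (l + 1) - truncatedCoeff b n l =
      ∑ a ∈ Finset.range (b + 1), zdiff l (subsetSumPoly a n) := by
  simp only [truncatedCoeff, zdiff_apply, Finset.sum_sub_distrib]

theorem isUnimodalPoly_rankGeneratingPoly_one {n : ℕ} (hn : 1 ≤ n) :
    IsUnimodalPoly (rankGeneratingPoly n 1) := by
  refine isUnimodalPoly_of_peak le_rfl n (fun l _ _ => by omega) (fun l h1 h2 => ?_)
  simp at h2
  omega

theorem isUnimodalPoly_rankGeneratingPoly_two {n : ℕ} (hn : 1 ≤ n) :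
    IsUnimodalPoly (rankGeneratingPoly n 2) := by
  refine isUnimodalPoly_of_peak one_le_two n (fun l _ _ => by omega) (fun l h1 h2 => ?_)
  rw [← sub_nonpos, truncatedCoeff_sub, Finset.sum_range_succ, Finset.sum_range_succ,
    Finset.sum_range_one, zdiff_subsetSumPoly_zero (by omega), zdiff_subsetSumPoly_one]
  have h := two_mul_zdiff_subsetSumPoly_two n l
  have key : 2 * (powerSumCoeff 1 n (l + 1) - powerSumCoeff 1 n l) +
      (powerSumCoeff 1 n l - powerSumCoeff 1 n (l - n) -
        (powerSumCoeff 2 n (l + 1) - powerSumCoeff 2 n l)) ≤ 0 := by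
    have : l ≤ n + 1 := by push_cast at h2; linarith
    unfold powerSumCoeff
    push_cast
    obtain rfl | rfl : l = n ∨ l = n + 1 := by omega
    · omega
    · omega
  have key' := (Int.cast_le (R := ℚ)).2 key
  push_cast at key' h
  linarith

theorem six_mul_truncatedCoeff_three_sub {n : ℕ} {l : ℤ} (hl : 1 ≤ l) :
    6 * (truncatedCoeff 3 n (l + 1) - truncatedCoeff 3 n l) =
      ((tentCoeff n l - tentCoeff n (l - n) -
      3 * (powerSumCoeff 2 n l - powerSumCoeff 2 n (l - n)) +
      2 * (powerSumCoeff 3 n (l + 1) - powerSumCoeff 3 n l) +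
      3 * (powerSumCoeff 1 n l - powerSumCoeff 1 n (l - n) -
        (powerSumCoeff 2 n (l + 1) - powerSumCoeff 2 n l)) +
      6 * (powerSumCoeff 1 n (l + 1) - powerSumCoeff 1 n l) : ℤ) : ℚ) := by
  rw [truncatedCoeff_sub, Finset.sum_range_succ, Finset.sum_range_succ, Finset.sum_range_succ,
    Finset.sum_range_one, zdiff_subsetSumPoly_zero hl, zdiff_subsetSumPoly_one]
  have h2 := two_mul_zdiff_subsetSumPoly_two n l
  have h3 := six_mul_zdiff_subsetSumPoly_three n l
  push_cast at h2 h3 ⊢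
  linarith

theorem twentyfour_mul_truncatedCoeff_four_sub {n : ℕ} {l : ℤ} (hl : 1 ≤ l) :
    24 * (truncatedCoeff 4 n (l + 1) - truncatedCoeff 4 n l) =
      ((cubeCoeff n l - cubeCoeff n (l - n) -
      6 * (oneTwoCoeff n l - oneTwoCoeff n (l - n)) +
      3 * (twoTwoCoeff n (l + 1) - twoTwoCoeff n l) +
      8 * (powerSumCoeff 3 n l - powerSumCoeff 3 n (l - n)) -
      6 * (powerSumCoeff 4 n (l + 1) - powerSumCoeff 4 n l) +
      4 * (tentCoeff n l - tentCoeff n (l - n) -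
      3 * (powerSumCoeff 2 n l - powerSumCoeff 2 n (l - n)) +
      2 * (powerSumCoeff 3 n (l + 1) - powerSumCoeff 3 n l)) +
      12 * (powerSumCoeff 1 n l - powerSumCoeff 1 n (l - n) -
        (powerSumCoeff 2 n (l + 1) - powerSumCoeff 2 n l)) +
      24 * (powerSumCoeff 1 n (l + 1) - powerSumCoeff 1 n l) : ℤ) : ℚ) := by
  rw [truncatedCoeff_sub, Finset.sum_range_succ, Finset.sum_range_succ, Finset.sum_range_succ,
    Finset.sum_range_succ, Finset.sum_range_one, zdiff_subsetSumPoly_zero hl,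
    zdiff_subsetSumPoly_one]
  have h2 := two_mul_zdiff_subsetSumPoly_two n l
  have h3 := six_mul_zdiff_subsetSumPoly_three n l
  have h4 := twentyfour_mul_zdiff_subsetSumPoly_four n l
  push_cast at h2 h3 h4 ⊢
  linarith

theorem ediv_sub_one_le (l : ℤ) (k : ℕ) : (l - 1) / (k : ℤ) ≤ l / k := by
  rcases Nat.eq_zero_or_pos k with rfl | hk
  · simp
  · exact Int.ediv_le_ediv (by exact_mod_cast hk) (by omega)

theorem powerSumCoeff_of_nonpos {k n : ℕ} {l : ℤ} (hl : l ≤ 0) :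
    powerSumCoeff k n l = 0 := by
  have h1 : l / (k : ℤ) ≤ 0 :=
    by
    rcases Nat.eq_zero_or_pos k with rfl | hk
    · simp
    · simpa using Int.ediv_le_ediv (c := k) (by exact_mod_cast hk) hl
  have h2 := ediv_sub_one_le l k
  unfold powerSumCoeff
  omega

theorem powerSumCoeff_of_le {k n : ℕ} {l : ℤ} (hl : 1 ≤ l) (h : l / k ≤ n) :
    powerSumCoeff k n l = l / k - (l - 1) / k := by
  have h1 : 0 ≤ (l - 1) / (k : ℤ) := Int.ediv_nonneg (by omega) (by omega)
  have h2 : (l - 1) / (k : ℤ) ≤ l / k := ediv_sub_one_le _ _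
  unfold powerSumCoeff
  omega

theorem powerSumCoeff_of_gt {k n : ℕ} {l : ℤ} (h : n ≤ (l - 1) / k) : powerSumCoeff k n l = 0 := by
  have h2 : (l - 1) / (k : ℤ) ≤ l / k := ediv_sub_one_le _ _
  unfold powerSumCoeff
  omega

theorem isUnimodalPoly_rankGeneratingPoly_three {n : ℕ} (hn : 12 ≤ n) :
    IsUnimodalPoly (rankGeneratingPoly n 3) := by
  refine isUnimodalPoly_of_peak (by norm_num) (3 * n / 2) (fun l h1 h2 => ?_) (fun l h1 h2 => ?_)
  · have h2' : 2 * l + 2 ≤ 3 * n := by push_cast at h2; omega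
    clear h2
    rw [← sub_nonneg]
    refine (mul_nonneg_iff_of_pos_left (by norm_num : (0 : ℚ) < 6)).1 ?_
    rw [six_mul_truncatedCoeff_three_sub (n := n) (l := l) (by omega), Int.cast_nonneg_iff]
    -- At `l = n` the tent at `l - n` is clamped to 0, whereas the formula used for larger `l` would
    -- give -1.
    rcases h1.eq_or_lt with rfl | h1
    · rw [powerSumCoeff_of_le (k := 2) (l := n) (by omega) (by omega),
        powerSumCoeff_of_nonpos (k := 2) (l := n - n) (by omega),
        powerSumCoeff_of_le (k := 2) (l := n + 1) (by omega) (by omega),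
        powerSumCoeff_of_le (k := 3) (l := n) (by omega) (by omega),
        powerSumCoeff_of_le (k := 3) (l := n + 1) (by omega) (by omega),
        powerSumCoeff_of_le (k := 1) (l := n) (by omega) (by omega),
        powerSumCoeff_of_gt (k := 1) (l := n + 1) (by push_cast; omega),
        powerSumCoeff_of_nonpos (k := 1) (l := n - n) (by omega)]
      rw [show tentCoeff n n = n - 1 by unfold tentCoeff; omega,
        show tentCoeff n (n - n) = 0 by unfold tentCoeff; omega]
      push_cast
      omega
    · rw [powerSumCoeff_of_le (k := 2) (l := l) (by omega) (by omega),
        powerSumCoeff_of_le (k := 2) (l := l - n) (by omega) (by omega),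
        powerSumCoeff_of_le (k := 2) (l := l + 1) (by omega) (by omega),
        powerSumCoeff_of_le (k := 3) (l := l) (by omega) (by omega),
        powerSumCoeff_of_le (k := 3) (l := l + 1) (by omega) (by omega),
        powerSumCoeff_of_gt (k := 1) (l := l) (by push_cast; omega),
        powerSumCoeff_of_gt (k := 1) (l := l + 1) (by push_cast; omega),
        powerSumCoeff_of_le (k := 1) (l := l - n) (by omega) (by push_cast; omega)]
      rw [show tentCoeff n l = 2 * n + 1 - l by unfold tentCoeff; omega,
        show tentCoeff n (l - n) = l - n - 1 by unfold tentCoeff; omega]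
      push_cast
      -- The remaining floors have divisors 2 and 3, with arguments in `l` and `l - n`; they become
      -- linear once `l` mod 6 and `n` mod 2 are fixed.
      have hl6 : l % 6 = 0 ∨ l % 6 = 1 ∨ l % 6 = 2 ∨ l % 6 = 3 ∨ l % 6 = 4 ∨ l % 6 = 5 := by omega
      rcases Int.emod_two_eq_zero_or_one n with hn2 | hn2 <;>
        rcases hl6 with hl6 | hl6 | hl6 | hl6 | hl6 | hl6 <;> omega
  · rw [← sub_nonpos]
    refine (mul_nonpos_iff_pos_imp_nonpos.1 ?_).1 (by norm_num : (0 : ℚ) < 6)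
    have h1' : 3 * n ≤ 2 * l + 1 := by push_cast at h1; omega
    have h2' : l ≤ 2 * n + 2 := by push_cast at h2; linarith
    clear h1 h2
    rw [six_mul_truncatedCoeff_three_sub (n := n) (l := l) (by omega), Int.cast_nonpos]
    rw [powerSumCoeff_of_gt (k := 1) (l := l) (by push_cast; omega),
      powerSumCoeff_of_gt (k := 1) (l := l + 1) (by push_cast; omega),
      powerSumCoeff_of_le (k := 2) (l := l - n) (by omega) (by omega),
      powerSumCoeff_of_le (k := 3) (l := l) (by omega) (by omega),
      powerSumCoeff_of_le (k := 3) (l := l + 1) (by omega) (by omega)]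
    rcases lt_or_ge (2 * (n : ℤ)) l with h | h
    · rw [powerSumCoeff_of_gt (k := 2) (l := l) (by omega),
        powerSumCoeff_of_gt (k := 2) (l := l + 1) (by omega)]
      unfold tentCoeff powerSumCoeff
      push_cast
      omega
    · rw [powerSumCoeff_of_le (k := 2) (l := l) (by omega) (by omega),
        powerSumCoeff_of_le (k := 2) (l := l + 1) (by omega) (by omega),
        powerSumCoeff_of_le (k := 1) (l := l - n) (by omega) (by push_cast; omega)]
      rw [show tentCoeff n l = 2 * n + 1 - l by unfold tentCoeff; omega,
        show tentCoeff n (l - n) = l - n - 1 by unfold tentCoeff; omega]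
      push_cast
      have hl6 : l % 6 = 0 ∨ l % 6 = 1 ∨ l % 6 = 2 ∨ l % 6 = 3 ∨ l % 6 = 4 ∨ l % 6 = 5 := by omega
      rcases Int.emod_two_eq_zero_or_one n with hn2 | hn2 <;>
        rcases hl6 with hl6 | hl6 | hl6 | hl6 | hl6 | hl6 <;> omega

/-! ### Unimodality for `b = 4` -/

theorem powerSumCoeff_nonneg (k n : ℕ) (l : ℤ) : 0 ≤ powerSumCoeff k n l := by
  have := ediv_sub_one_le l k
  unfold powerSumCoeff
  omega

theorem powerSumCoeff_le_one {k : ℕ} (hk : 0 < k) (n : ℕ) (l : ℤ) : powerSumCoeff k n l ≤ 1 := by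
  have h1 : l / (k : ℤ) ≤ (l - 1 + k) / k := Int.ediv_le_ediv (by exact_mod_cast hk) (by omega)
  rw [Int.add_ediv_of_dvd_right (dvd_refl _), Int.ediv_self (by omega)] at h1
  unfold powerSumCoeff
  omega

/-- The difference of consecutive coefficients of `24 * ∑ a ≤ 4, subsetSumPoly a n`, without the
contribution of the fourth power of the first power sum. -/
def quarticRemainder (n : ℕ) (l : ℤ) : ℤ :=
  -6 * (oneTwoCoeff n l - oneTwoCoeff n (l - n)) +
      3 * (twoTwoCoeff n (l + 1) - twoTwoCoeff n l) +
      8 * (powerSumCoeff 3 n l - powerSumCoeff 3 n (l - n)) -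
      6 * (powerSumCoeff 4 n (l + 1) - powerSumCoeff 4 n l) +
      4 * (tentCoeff n l - tentCoeff n (l - n) -
      3 * (powerSumCoeff 2 n l - powerSumCoeff 2 n (l - n)) +
      2 * (powerSumCoeff 3 n (l + 1) - powerSumCoeff 3 n l)) +
      12 * (powerSumCoeff 1 n l - powerSumCoeff 1 n (l - n) -
        (powerSumCoeff 2 n (l + 1) - powerSumCoeff 2 n l)) +
      24 * (powerSumCoeff 1 n (l + 1) - powerSumCoeff 1 n l)

theorem twentyfour_mul_truncatedCoeff_four_sub' {n : ℕ} {l : ℤ} (hl : 1 ≤ l) :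
    24 * (truncatedCoeff 4 n (l + 1) - truncatedCoeff 4 n l) =
      ((cubeCoeff n l - cubeCoeff n (l - n) + quarticRemainder n l : ℤ) : ℚ) := by
  rw [twentyfour_mul_truncatedCoeff_four_sub hl, quarticRemainder]
  congr 1
  ring

/-- The omitted terms are coefficients of single power sums, which are 0 or 1. The constant is not
sharp. -/
theorem abs_quarticRemainder_sub_le (n : ℕ) (l : ℤ) :
    |quarticRemainder n l - (-6 * (oneTwoCoeff n l - oneTwoCoeff n (l - n)) +
      3 * (twoTwoCoeff n (l + 1) - twoTwoCoeff n l) +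
      4 * (tentCoeff n l - tentCoeff n (l - n)))| ≤ 94 := by
  have h0 := fun k => powerSumCoeff_nonneg k n
  have h1 := fun k l => powerSumCoeff_le_one (Nat.succ_pos k) n l
  have := h0 1 l; have := h0 1 (l - n); have := h0 1 (l + 1)
  have := h0 2 l; have := h0 2 (l - n); have := h0 2 (l + 1)
  have := h0 3 l; have := h0 3 (l - n); have := h0 3 (l + 1)
  have := h0 4 l; have := h0 4 (l + 1)
  have := h1 0 l; have := h1 0 (l - n); have := h1 0 (l + 1)
  have := h1 1 l; have := h1 1 (l - n); have := h1 1 (l + 1)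
  have := h1 2 l; have := h1 2 (l - n); have := h1 2 (l + 1)
  have := h1 3 l; have := h1 3 (l + 1)
  simp only [Nat.succ_eq_add_one, zero_add, Nat.reduceAdd] at *
  rw [abs_le]
  unfold quarticRemainder
  constructor <;> linarith

theorem two_mul_cubeCoeff_sub_left {n : ℕ} {y : ℤ} (h0 : 0 ≤ y) (hn : y ≤ n) :
    2 * (cubeCoeff n (2 * n + 1 - y) - cubeCoeff n (2 * n + 1 - y - n)) =
      2 * n * (2 * y + 1) - 3 * y * (y + 1) := by
  unfold cubeCoeff
  rw [show (2 * n + 1 - y - 1 : ℤ) = 2 * n - y by ring,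
    show (2 * n - y - n : ℤ) = n - y by ring,
    show (2 * n + 1 - y - n - 1 : ℤ) = n - y by ring,
    choosePlus_of_nonpos (x := 2 * n - y - 2 * n) (by omega),
    choosePlus_of_nonpos (x := 2 * n - y - 3 * n) (by omega),
    choosePlus_of_nonpos (x := n - y - n) (by omega),
    choosePlus_of_nonpos (x := n - y - 2 * n) (by omega),
    choosePlus_of_nonpos (x := n - y - 3 * n) (by omega)]
  have h1 := two_mul_choosePlus (x := 2 * n - y) (by omega)
  have h2 := two_mul_choosePlus (x := n - y) (by omega)
  linear_combination h1 - 4 * h2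

theorem two_mul_cubeCoeff_sub_right {n : ℕ} {y : ℤ} (h0 : 0 ≤ y) (hn : y ≤ n) :
    2 * (cubeCoeff n (2 * n + 2 + y) - cubeCoeff n (2 * n + 2 + y - n)) =
      -(2 * n * (2 * y + 1) - 3 * y * (y + 1)) := by
  unfold cubeCoeff
  rw [show (2 * n + 2 + y - 1 : ℤ) = 2 * n + 1 + y by ring,
    show (2 * n + 1 + y - n : ℤ) = n + 1 + y by ring,
    show (2 * n + 1 + y - 2 * n : ℤ) = 1 + y by ring,
    show (2 * n + 2 + y - n - 1 : ℤ) = n + 1 + y by ring,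
    show (n + 1 + y - n : ℤ) = 1 + y by ring]
  have h1 := two_mul_choosePlus (x := 2 * n + 1 + y) (by omega)
  have h2 := two_mul_choosePlus (x := n + 1 + y) (by omega)
  have h3 := two_mul_choosePlus (x := 1 + y) (by omega)
  have h4 : ∀ x : ℤ, x ≤ 1 → choosePlus x = 0 := by
    intro x hx
    rcases hx.eq_or_lt with rfl | hx
    · rfl
    · exact choosePlus_of_nonpos (by omega)
  rw [h4 (2 * n + 1 + y - 3 * n) (by omega), h4 (n + 1 + y - 2 * n) (by omega),
    h4 (n + 1 + y - 3 * n) (by omega)]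
  linear_combination h1 - 4 * h2 + 6 * h3

theorem two_mul_cubeCoeff_sub_bottom {n : ℕ} (hn : 1 ≤ n) :
    2 * (cubeCoeff n n - cubeCoeff n (n - n)) = (n - 1) * (n - 2) := by
  unfold cubeCoeff
  have h1 := two_mul_choosePlus (x := n - 1) (by omega)
  rw [choosePlus_of_nonpos (x := n - 1 - n) (by omega),
    choosePlus_of_nonpos (x := n - 1 - 2 * n) (by omega),
    choosePlus_of_nonpos (x := n - 1 - 3 * n) (by omega),
    choosePlus_of_nonpos (x := n - n - 1) (by omega),
    choosePlus_of_nonpos (x := n - n - 1 - n) (by omega),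
    choosePlus_of_nonpos (x := n - n - 1 - 2 * n) (by omega),
    choosePlus_of_nonpos (x := n - n - 1 - 3 * n) (by omega)]
  linear_combination h1

theorem two_mul_cubeCoeff_sub_top {n : ℕ} (hn : 3 ≤ n) :
    2 * (cubeCoeff n (3 * n + 3) - cubeCoeff n (3 * n + 3 - n)) = -(n - 1) * (n - 2) := by
  unfold cubeCoeff
  rw [show (3 * n + 3 - 1 : ℤ) = 3 * n + 2 by ring,
    show (3 * n + 2 - n : ℤ) = 2 * n + 2 by ring,
    show (3 * n + 2 - 2 * n : ℤ) = n + 2 by ring,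
    show (3 * n + 2 - 3 * n : ℤ) = 2 by ring,
    show (3 * n + 3 - n - 1 : ℤ) = 2 * n + 2 by ring,
    show (2 * n + 2 - n : ℤ) = n + 2 by ring,
    show (2 * n + 2 - 2 * n : ℤ) = 2 by ring,
    choosePlus_of_nonpos (x := 2 * n + 2 - 3 * n) (by omega)]
  have h1 := two_mul_choosePlus (x := 3 * n + 2) (by omega)
  have h2 := two_mul_choosePlus (x := 2 * n + 2) (by omega)
  have h3 := two_mul_choosePlus (x := n + 2) (by omega)
  have h4 := two_mul_choosePlus (x := 2) (by omega)
  linear_combination h1 - 4 * h2 + 6 * h3 - 4 * h4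

/-- The parity of `y` matters because `twoTwoCoeff` vanishes at odd exponents: its difference is
about -n here and about +n for even `y`, when `y` is small. -/
theorem quarticRemainder_left_odd {n : ℕ} {y : ℤ} (hn : 4 ≤ n) (h0 : 1 ≤ y) (hy : y ≤ n)
    (h2 : y % 2 = 1) :
    |quarticRemainder n (2 * n + 1 - y) - (-7 * n + 6 * y)| ≤ y + 200 := by
  have h := abs_quarticRemainder_sub_le n (2 * n + 1 - y)
  obtain ⟨m, rfl⟩ : ∃ m, y = 2 * m + 1 := ⟨y / 2, by omega⟩
  have hV : oneTwoCoeff n (2 * n + 1 - (2 * m + 1)) = n - m - 1 - (n + 1 - 2 * m) / 2 + 1 := by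
    unfold oneTwoCoeff; omega
  have hV' : oneTwoCoeff n (2 * n + 1 - (2 * m + 1) - n) = (n - 2 * m - 1) / 2 := by
    unfold oneTwoCoeff; omega
  have hT : twoTwoCoeff n (2 * n + 1 - (2 * m + 1) + 1) = 0 := by
    unfold twoTwoCoeff; rw [if_neg (by omega)]
  have hT' : twoTwoCoeff n (2 * n + 1 - (2 * m + 1)) = n - m - 1 := by
    unfold twoTwoCoeff tentCoeff; rw [if_pos (by omega)]; omega
  have hW : tentCoeff n (2 * n + 1 - (2 * m + 1)) = 2 * m + 1 := by unfold tentCoeff; omega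
  have hW' : tentCoeff n (2 * n + 1 - (2 * m + 1) - n) = n - (2 * m + 1) := by
    unfold tentCoeff; omega
  rw [hV, hV', hT, hT', hW, hW', abs_le] at h
  rw [abs_le]
  generalize quarticRemainder n (2 * n + 1 - (2 * m + 1)) = r at *
  omega

theorem quarticRemainder_left_even {n : ℕ} {y : ℤ} (hn : 4 ≤ n) (h0 : 0 ≤ y) (hy : y ≤ n)
    (h2 : y % 2 = 0) :
    |quarticRemainder n (2 * n + 1 - y) - (-n + 3 * y)| ≤ y + 200 := by
  have h := abs_quarticRemainder_sub_le n (2 * n + 1 - y)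
  obtain ⟨m, rfl⟩ : ∃ m, y = 2 * m := ⟨y / 2, by omega⟩
  have hV : oneTwoCoeff n (2 * n + 1 - 2 * m) = n - m - (n + 2 - 2 * m) / 2 + 1 := by
    unfold oneTwoCoeff; omega
  have hV' : oneTwoCoeff n (2 * n + 1 - 2 * m - n) = (n - 2 * m) / 2 := by
    unfold oneTwoCoeff; omega
  have hT : twoTwoCoeff n (2 * n + 1 - 2 * m + 1) = n - m := by
    unfold twoTwoCoeff tentCoeff; rw [if_pos (by omega)]; omega
  have hT' : twoTwoCoeff n (2 * n + 1 - 2 * m) = 0 := by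
    unfold twoTwoCoeff; rw [if_neg (by omega)]
  have hW : tentCoeff n (2 * n + 1 - 2 * m) = 2 * m := by unfold tentCoeff; omega
  have hW' : tentCoeff n (2 * n + 1 - 2 * m - n) = n - 2 * m := by
    unfold tentCoeff; omega
  rw [hV, hV', hT, hT', hW, hW', abs_le] at h
  rw [abs_le]
  generalize quarticRemainder n (2 * n + 1 - 2 * m) = r at *
  omega

theorem twoTwoCoeff_nonneg (n : ℕ) (l : ℤ) : 0 ≤ twoTwoCoeff n l := by
  unfold twoTwoCoeff tentCoeff; split_ifs <;> omega

theorem twoTwoCoeff_le (n : ℕ) (l : ℤ) : twoTwoCoeff n l ≤ n := by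
  unfold twoTwoCoeff tentCoeff; split_ifs <;> omega

theorem quarticRemainder_right {n : ℕ} {y : ℤ} (hn : 4 ≤ n) (h0 : 0 ≤ y) (hy : y ≤ n) :
    quarticRemainder n (2 * n + 2 + y) ≤ -n + 7 * y + 200 := by
  have h := abs_quarticRemainder_sub_le n (2 * n + 2 + y)
  have hV : oneTwoCoeff n (2 * n + 2 + y) = n - (n + 3 + y) / 2 + 1 := by
    unfold oneTwoCoeff; omega
  have hV' : oneTwoCoeff n (2 * n + 2 + y - n) = (n + 1 + y) / 2 - (y + 3) / 2 + 1 := by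
    unfold oneTwoCoeff; omega
  have hT := twoTwoCoeff_le n (2 * n + 2 + y + 1)
  have hT' := twoTwoCoeff_nonneg n (2 * n + 2 + y)
  have hW : tentCoeff n (2 * n + 2 + y) = 0 := by unfold tentCoeff; omega
  have hW' : n - y - 1 ≤ tentCoeff n (2 * n + 2 + y - n) := by unfold tentCoeff; omega
  rw [hV, hV', hW, abs_le] at h
  generalize quarticRemainder n (2 * n + 2 + y) = r at *
  omega

theorem abs_quarticRemainder_le (n : ℕ) (l : ℤ) : |quarticRemainder n l| ≤ 13 * n + 200 := by
  have h := abs_quarticRemainder_sub_le n l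
  have hV : ∀ l, 0 ≤ oneTwoCoeff n l ∧ oneTwoCoeff n l ≤ n := by
    intro l; unfold oneTwoCoeff; omega
  have hW : ∀ l, 0 ≤ tentCoeff n l ∧ tentCoeff n l ≤ n := by
    intro l; unfold tentCoeff; omega
  have := hV l; have := hV (l - n); have := hW l; have := hW (l - n)
  have := twoTwoCoeff_le n (l + 1); have := twoTwoCoeff_le n l
  have := twoTwoCoeff_nonneg n (l + 1); have := twoTwoCoeff_nonneg n l
  rw [abs_le] at h ⊢
  omega

/-- An estimate would not do: the cubic part at this exponent is exactly `n`, so the coefficients at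
`2 * n + 1` and `2 * n + 2` coincide. -/
theorem quarticRemainder_two_mul_add_one {n : ℕ} (hn : 12 ≤ n) :
    quarticRemainder n (2 * n + 1) = -n := by
  unfold quarticRemainder
  rw [powerSumCoeff_of_gt (k := 1) (l := 2 * n + 1) (by push_cast; omega),
    powerSumCoeff_of_gt (k := 1) (l := 2 * n + 1 + 1) (by push_cast; omega),
    powerSumCoeff_of_gt (k := 1) (l := 2 * n + 1 - n) (by push_cast; omega),
    powerSumCoeff_of_gt (k := 2) (l := 2 * n + 1) (by push_cast; omega),
    powerSumCoeff_of_gt (k := 2) (l := 2 * n + 1 + 1) (by push_cast; omega),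
    powerSumCoeff_of_le (k := 2) (l := 2 * n + 1 - n) (by omega) (by push_cast; omega),
    powerSumCoeff_of_le (k := 3) (l := 2 * n + 1) (by omega) (by push_cast; omega),
    powerSumCoeff_of_le (k := 3) (l := 2 * n + 1 + 1) (by omega) (by push_cast; omega),
    powerSumCoeff_of_le (k := 3) (l := 2 * n + 1 - n) (by omega) (by push_cast; omega),
    powerSumCoeff_of_le (k := 4) (l := 2 * n + 1) (by omega) (by push_cast; omega),
    powerSumCoeff_of_le (k := 4) (l := 2 * n + 1 + 1) (by omega) (by push_cast; omega),
    show oneTwoCoeff n (2 * n + 1) = n - (n + 2) / 2 + 1 by unfold oneTwoCoeff; omega,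
    show oneTwoCoeff n (2 * n + 1 - n) = n / 2 by unfold oneTwoCoeff; omega,
    show twoTwoCoeff n (2 * n + 1 + 1) = n by
      unfold twoTwoCoeff tentCoeff; rw [if_pos (by omega)]; omega,
    show twoTwoCoeff n (2 * n + 1) = 0 by unfold twoTwoCoeff; rw [if_neg (by omega)],
    show tentCoeff n (2 * n + 1) = 0 by unfold tentCoeff; omega,
    show tentCoeff n (2 * n + 1 - n) = n by unfold tentCoeff; omega]
  push_cast
  have h : n % 12 = 0 ∨ n % 12 = 1 ∨ n % 12 = 2 ∨ n % 12 = 3 ∨ n % 12 = 4 ∨ n % 12 = 5 ∨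
    n % 12 = 6 ∨ n % 12 = 7 ∨ n % 12 = 8 ∨ n % 12 = 9 ∨ n % 12 = 10 ∨ n % 12 = 11 := by omega
  rcases h with h | h | h | h | h | h | h | h | h | h | h | h <;> omega

/-- Again the cancellation is exact: the cubic part is `7 * n - 18`, and the coefficients at `2 * n
- 2` and `2 * n - 1` coincide. -/
theorem quarticRemainder_two_mul_sub_two {n : ℕ} (hn : 12 ≤ n) :
    quarticRemainder n (2 * n - 2) = -7 * n + 18 := by
  unfold quarticRemainder
  rw [powerSumCoeff_of_gt (k := 1) (l := 2 * n - 2) (by push_cast; omega),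
    powerSumCoeff_of_gt (k := 1) (l := 2 * n - 2 + 1) (by push_cast; omega),
    powerSumCoeff_of_le (k := 1) (l := 2 * n - 2 - n) (by omega) (by push_cast; omega),
    powerSumCoeff_of_le (k := 2) (l := 2 * n - 2) (by omega) (by push_cast; omega),
    powerSumCoeff_of_le (k := 2) (l := 2 * n - 2 + 1) (by omega) (by push_cast; omega),
    powerSumCoeff_of_le (k := 2) (l := 2 * n - 2 - n) (by omega) (by push_cast; omega),
    powerSumCoeff_of_le (k := 3) (l := 2 * n - 2) (by omega) (by push_cast; omega),
    powerSumCoeff_of_le (k := 3) (l := 2 * n - 2 + 1) (by omega) (by push_cast; omega),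
    powerSumCoeff_of_le (k := 3) (l := 2 * n - 2 - n) (by omega) (by push_cast; omega),
    powerSumCoeff_of_le (k := 4) (l := 2 * n - 2) (by omega) (by push_cast; omega),
    powerSumCoeff_of_le (k := 4) (l := 2 * n - 2 + 1) (by omega) (by push_cast; omega),
    show oneTwoCoeff n (2 * n - 2) = n - 2 - (n - 1) / 2 + 1 by unfold oneTwoCoeff; omega,
    show oneTwoCoeff n (2 * n - 2 - n) = (n - 3) / 2 by unfold oneTwoCoeff; omega,
    show twoTwoCoeff n (2 * n - 2 + 1) = 0 by unfold twoTwoCoeff; rw [if_neg (by omega)],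
    show twoTwoCoeff n (2 * n - 2) = n - 2 by
      unfold twoTwoCoeff tentCoeff; rw [if_pos (by omega)]; omega,
    show tentCoeff n (2 * n - 2) = 3 by unfold tentCoeff; omega,
    show tentCoeff n (2 * n - 2 - n) = n - 3 by unfold tentCoeff; omega]
  push_cast
  have h : n % 12 = 0 ∨ n % 12 = 1 ∨ n % 12 = 2 ∨ n % 12 = 3 ∨ n % 12 = 4 ∨ n % 12 = 5 ∨
    n % 12 = 6 ∨ n % 12 = 7 ∨ n % 12 = 8 ∨ n % 12 = 9 ∨ n % 12 = 10 ∨ n % 12 = 11 := by omega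
  rcases h with h | h | h | h | h | h | h | h | h | h | h | h <;> omega

theorem isUnimodalPoly_rankGeneratingPoly_four {n : ℕ} (hn : 1000 ≤ n) :
    IsUnimodalPoly (rankGeneratingPoly n 4) := by
  refine isUnimodalPoly_of_peak (by norm_num) (2 * n) (fun l h1 h2 => ?_) (fun l h1 h2 => ?_)
  · push_cast at h2
    rw [← sub_nonneg]
    refine (mul_nonneg_iff_of_pos_left (by norm_num : (0 : ℚ) < 24)).1 ?_
    rw [twentyfour_mul_truncatedCoeff_four_sub' (by omega), Int.cast_nonneg_iff]
    have hn' : (1000 : ℤ) ≤ n := by exact_mod_cast hn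
    rcases h1.eq_or_lt with rfl | h1
    · have hc := two_mul_cubeCoeff_sub_bottom (n := n) (by omega)
      have hr := abs_le.1 (abs_quarticRemainder_le n n)
      nlinarith
    · obtain ⟨y, rfl⟩ : ∃ y, l = 2 * n + 1 - y := ⟨2 * n + 1 - l, by ring⟩
      have hc := two_mul_cubeCoeff_sub_left (n := n) (y := y) (by omega) (by omega)
      rcases Int.emod_two_eq_zero_or_one y with hy | hy
      · have hr := abs_le.1 (quarticRemainder_left_even (n := n) (by omega) (by omega) (by omega) hy)
        -- The cubic part is a concave quadratic in `y`; this product bounds it below by its chord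
        -- on [2, n].
        have : 0 ≤ (y - 2) * (n - y) := mul_nonneg (by omega) (by omega)
        nlinarith
      · have hr := abs_le.1 (quarticRemainder_left_odd (n := n) (by omega) (by omega) (by omega) hy)
        rcases lt_or_ge y 5 with hy5 | hy5
        · obtain rfl : y = 3 := by omega
          have hr' := quarticRemainder_two_mul_sub_two (n := n) (by omega)
          rw [show (2 * n + 1 - 3 : ℤ) = 2 * n - 2 by ring] at hc ⊢
          linarith
        · have : 0 ≤ (y - 5) * (n - y) := mul_nonneg (by omega) (by omega)
          nlinarith
  · push_cast at h1 h2
    rw [← sub_nonpos]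
    refine (mul_nonpos_iff_pos_imp_nonpos.1 ?_).1 (by norm_num : (0 : ℚ) < 24)
    rw [twentyfour_mul_truncatedCoeff_four_sub' (by omega), Int.cast_nonpos]
    have hn' : (1000 : ℤ) ≤ n := by exact_mod_cast hn
    obtain rfl | rfl | rfl | ⟨h3, h4⟩ : l = 2 * n ∨ l = 2 * n + 1 ∨ l = 3 * n + 3 ∨
      (2 * n + 2 ≤ l ∧ l ≤ 3 * n + 2) := by omega
    -- The descent starts here: the cubic part `3 * n - 3` is outweighed by a remainder near `-7 *
    -- n`.
    · have hc := two_mul_cubeCoeff_sub_left (n := n) (y := 1) (by omega) (by omega)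
      have hr := abs_le.1 (quarticRemainder_left_odd (n := n) (y := 1) (by omega) (by omega)
        (by omega) rfl)
      rw [show (2 * n + 1 - 1 : ℤ) = 2 * n by ring] at hc hr
      linarith
    · have hc := two_mul_cubeCoeff_sub_left (n := n) (y := 0) (by omega) (by omega)
      have hr := quarticRemainder_two_mul_add_one (n := n) (by omega)
      rw [show (2 * n + 1 - 0 : ℤ) = 2 * n + 1 by ring] at hc
      linarith
    · have hc := two_mul_cubeCoeff_sub_top (n := n) (by omega)
      have hr := abs_le.1 (abs_quarticRemainder_le n (3 * n + 3))
      nlinarith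
    · obtain ⟨y, rfl⟩ : ∃ y, l = 2 * n + 2 + y := ⟨l - (2 * n + 2), by ring⟩
      have hc := two_mul_cubeCoeff_sub_right (n := n) (y := y) (by omega) (by omega)
      have hr := quarticRemainder_right (n := n) (y := y) (by omega) (by omega) (by omega)
      have : 0 ≤ y * (n - y) := mul_nonneg (by omega) (by omega)
      nlinarith

/-! ### Orders of growth of coefficients -/

/-- The coefficients of the polynomials `u n` are `O(n ^ d)`, uniformly in the exponent. -/
def HasCoeffOrder (u : ℕ → Polynomial ℚ) (d : ℕ) : Prop :=
  ∃ C : ℚ, 0 ≤ C ∧ ∀ n : ℕ, 1 ≤ n → ∀ l : ℤ, |zcoeff l (u n)| ≤ C * (n : ℚ) ^ d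

namespace HasCoeffOrder

variable {u v : ℕ → Polynomial ℚ} {d e : ℕ}

theorem zero (d : ℕ) : HasCoeffOrder (fun _ => 0) d := ⟨0, le_rfl, by simp⟩

theorem mono (h : HasCoeffOrder u d) (hde : d ≤ e) : HasCoeffOrder u e := by
  obtain ⟨C, hC, h⟩ := h
  refine ⟨C, hC, fun n hn l => (h n hn l).trans ?_⟩
  have : (1 : ℚ) ≤ n := by exact_mod_cast hn
  gcongr

theorem add (hu : HasCoeffOrder u d) (hv : HasCoeffOrder v d) :
    HasCoeffOrder (fun n => u n + v n) d := by
  obtain ⟨C, hC, hu⟩ := hu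
  obtain ⟨C', hC', hv⟩ := hv
  refine ⟨C + C', by positivity, fun n hn l => ?_⟩
  rw [map_add, add_mul]
  exact (abs_add_le _ _).trans (add_le_add (hu n hn l) (hv n hn l))

theorem smul (c : ℚ) (hu : HasCoeffOrder u d) : HasCoeffOrder (fun n => c • u n) d := by
  obtain ⟨C, hC, hu⟩ := hu
  refine ⟨|c| * C, by positivity, fun n hn l => ?_⟩
  rw [map_smul, smul_eq_mul, abs_mul, mul_assoc]
  exact mul_le_mul_of_nonneg_left (hu n hn l) (abs_nonneg c)

theorem sub (hu : HasCoeffOrder u d) (hv : HasCoeffOrder v d) :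
    HasCoeffOrder (fun n => u n - v n) d := by
  simpa [sub_eq_add_neg] using hu.add (hv.smul (-1))

theorem sum {ι : Type*} (s : Finset ι) {w : ι → ℕ → Polynomial ℚ}
    (h : ∀ i ∈ s, HasCoeffOrder (w i) d) : HasCoeffOrder (fun n => ∑ i ∈ s, w i n) d := by
  classical
  induction s using Finset.induction_on with
  | empty => simpa using zero d
  | insert i s hi ih =>
    simp only [Finset.sum_insert hi]
    exact (h i (Finset.mem_insert_self _ _)).add
      (ih fun j hj => h j (Finset.mem_insert_of_mem hj))

theorem X_pow_mul (k : ℕ → ℕ) (hu : HasCoeffOrder u d) :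
    HasCoeffOrder (fun n => Polynomial.X ^ k n * u n) d := by
  obtain ⟨C, hC, hu⟩ := hu
  refine ⟨C, hC, fun n hn l => ?_⟩
  rw [zcoeff_X_pow_mul]
  exact hu n hn _

theorem one_sub_X_pow_mul (k : ℕ → ℕ) (hu : HasCoeffOrder u d) :
    HasCoeffOrder (fun n => (1 - Polynomial.X ^ k n) * u n) d := by
  simpa [sub_mul] using hu.sub (hu.X_pow_mul k)

theorem one_sub_X_mul (hu : HasCoeffOrder u d) :
    HasCoeffOrder (fun n => (1 - Polynomial.X) * u n) d := by
  simpa using hu.one_sub_X_pow_mul fun _ => 1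

theorem one : HasCoeffOrder (fun _ => 1) 0 := by
  refine ⟨1, zero_le_one, fun n _ l => ?_⟩
  rw [zcoeff_one]
  split_ifs <;> simp

theorem powerSumPoly_mul (k : ℕ) (hu : HasCoeffOrder u d) :
    HasCoeffOrder (fun n => _root_.powerSumPoly k n * u n) (d + 1) := by
  obtain ⟨C, hC, hu⟩ := hu
  refine ⟨C, hC, fun n hn l => ?_⟩
  beta_reduce
  rw [_root_.powerSumPoly, Finset.sum_mul, map_sum]
  refine (Finset.abs_sum_le_sum_abs _ _).trans ?_
  refine (Finset.sum_le_card_nsmul _ _ (C * (n : ℚ) ^ d) fun i _ => ?_).trans ?_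
  · rw [zcoeff_X_pow_mul]
    exact hu n hn _
  · rw [Nat.card_Icc, Nat.add_sub_cancel, nsmul_eq_mul, pow_succ]
    linarith

theorem powerSumPoly {k : ℕ} (hk : 1 ≤ k) : HasCoeffOrder (powerSumPoly k) 0 := by
  refine ⟨1, zero_le_one, fun n _ l => ?_⟩
  rw [_root_.powerSumPoly, map_sum]
  simp only [zcoeff_X_pow]
  rw [Finset.sum_boole, Nat.abs_cast, pow_zero, mul_one, Nat.cast_le_one, Finset.card_le_one]
  intro i hi j hj
  simp only [Finset.mem_filter] at hi hj
  have : k * i = k * j := by exact_mod_cast hi.2.symm.trans hj.2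
  exact Nat.eq_of_mul_eq_mul_left hk this

theorem powerSumPoly_one_pow_mul (i : ℕ) (hu : HasCoeffOrder u d) :
    HasCoeffOrder (fun n => _root_.powerSumPoly 1 n ^ i * u n) (i + d) := by
  induction i with
  | zero => simpa using hu
  | succ i ih =>
    have := ih.powerSumPoly_mul 1
    rw [show i + 1 + d = i + d + 1 by ring]
    simpa only [pow_succ', mul_assoc] using this

/-- The first factor has bounded coefficients; each further one costs a factor `n`. -/
theorem powerSumPoly_one_pow (i : ℕ) :
    HasCoeffOrder (fun n => _root_.powerSumPoly 1 n ^ i) (i - 1) := by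
  cases i with
  | zero => simpa using one
  | succ i =>
    simpa [pow_succ] using (HasCoeffOrder.powerSumPoly le_rfl).powerSumPoly_one_pow_mul i

end HasCoeffOrder

theorem one_sub_X_mul_powerSumPoly_one (n : ℕ) :
    (1 - Polynomial.X) * powerSumPoly 1 n = Polynomial.X * (1 - Polynomial.X ^ n) := by
  simpa using one_sub_X_pow_mul_powerSumPoly 1 n

/-- By telescoping, a factor 1 - X paired with a factor P costs no power of `n`. -/
theorem HasCoeffOrder.one_sub_X_mul_powerSumPoly_one_mul {u : ℕ → Polynomial ℚ} {d : ℕ}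
    (hu : HasCoeffOrder u d) :
    HasCoeffOrder (fun n => (1 - Polynomial.X) * (_root_.powerSumPoly 1 n * u n)) d := by
  have := (hu.one_sub_X_pow_mul fun n => n).X_pow_mul fun _ => 1
  simpa only [← mul_assoc, one_sub_X_mul_powerSumPoly_one, pow_one] using this

/-! ### The remainder in Newton's expansion -/

/-- Sums of terms `P ^ i * R`, where `P` is the first power sum and the coefficients of `R` have
order `j / 2 - 1` for some `j ≥ 2` with `i + j = b`. -/
inductive IsPowerSumRemainder (b : ℕ) : (ℕ → Polynomial ℚ) → Prop
  | zero : IsPowerSumRemainder b fun _ => 0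
  | term (i j : ℕ) (R : ℕ → Polynomial ℚ) (hij : i + j = b) (hj : 2 ≤ j)
      (hR : HasCoeffOrder R (j / 2 - 1)) :
      IsPowerSumRemainder b fun n => powerSumPoly 1 n ^ i * R n
  | add (u v : ℕ → Polynomial ℚ) (hu : IsPowerSumRemainder b u) (hv : IsPowerSumRemainder b v) :
      IsPowerSumRemainder b fun n => u n + v n

namespace IsPowerSumRemainder

variable {b : ℕ} {u : ℕ → Polynomial ℚ}

theorem smul (c : ℚ) (h : IsPowerSumRemainder b u) :
    IsPowerSumRemainder b fun n => c • u n := by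
  induction h with
  | zero => simpa using zero
  | term i j R hij hj hR =>
    simpa only [mul_smul_comm] using term i j (fun n => c • R n) hij hj (hR.smul c)
  | add u v _ _ hu hv => simpa only [smul_add] using add _ _ hu hv

theorem powerSumPoly_one_mul (h : IsPowerSumRemainder b u) :
    IsPowerSumRemainder (b + 1) fun n => powerSumPoly 1 n * u n := by
  induction h with
  | zero => simpa using zero
  | term i j R hij hj hR =>
    simpa only [pow_succ', mul_assoc] using term (i + 1) j R (by omega) hj hR
  | add u v _ _ hu hv => simpa only [mul_add] using add _ _ hu hv

theorem powerSumPoly_mul {k : ℕ} (hk : 2 ≤ k) (h : IsPowerSumRemainder b u) :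
    IsPowerSumRemainder (b + k) fun n => powerSumPoly k n * u n := by
  induction h with
  | zero => simpa using zero
  | term i j R hij hj hR =>
    -- As `k ≥ 2`, the allowed order `j / 2 - 1` grows by at least the one power of `n` that the new
    -- factor costs.
    have := term (b := b + k) i (j + k) (fun n => powerSumPoly k n * R n) (by omega) (by omega)
      ((hR.powerSumPoly_mul k).mono (by omega))
    simpa only [mul_left_comm] using this
  | add u v _ _ hu hv => simpa only [mul_add] using add _ _ hu hv

theorem sum {ι : Type*} (s : Finset ι) {w : ι → ℕ → Polynomial ℚ}
    (h : ∀ i ∈ s, IsPowerSumRemainder b (w i)) :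
    IsPowerSumRemainder b (fun n => ∑ i ∈ s, w i n) := by
  classical
  induction s using Finset.induction_on with
  | empty => simpa using zero
  | insert i s hi ih =>
    simp only [Finset.sum_insert hi]
    exact (h i (Finset.mem_insert_self _ _)).add _ _
      (ih fun j hj => h j (Finset.mem_insert_of_mem hj))

/-- If `i > 0`, one factor P is absorbed and the order is (i - 1) + (j/2 - 1), at most b - 3 since
`j ≥ 2`. If `i = 0`, the order b/2 - 1 is already small enough. -/
theorem hasCoeffOrder_one_sub_X_mul (h : IsPowerSumRemainder b u) {d : ℕ}
    (hd : b - 3 ≤ d) : HasCoeffOrder (fun n => (1 - Polynomial.X) * u n) d := by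
  induction h with
  | zero => simpa using HasCoeffOrder.zero d
  | term i j R hij hj hR =>
    cases i with
    | zero => simpa using (hR.mono (by omega)).one_sub_X_mul
    | succ i =>
      have := (hR.powerSumPoly_one_pow_mul i).one_sub_X_mul_powerSumPoly_one_mul
      refine HasCoeffOrder.mono (d := i + (j / 2 - 1)) ?_ (by omega)
      simpa only [pow_succ', mul_assoc] using this
  | add u v _ _ hu hv => simpa only [mul_add] using hu.add hv

/-- Up to two factors P are absorbed. The exception is `b = 4` with `i = 0`: the square of the
second power sum has order 1 and no factor P to absorb. This is why `b = 4` escapes the asymptotic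
argument. -/
theorem hasCoeffOrder_one_sub_X_sq_mul (h : IsPowerSumRemainder b u) {d : ℕ}
    (h4 : b - 4 ≤ d) (h5 : b = 4 → 1 ≤ d) :
    HasCoeffOrder (fun n => (1 - Polynomial.X) * ((1 - Polynomial.X) * u n)) d := by
  induction h with
  | zero => simpa using HasCoeffOrder.zero d
  | term i j R hij hj hR =>
    match i with
    | 0 => simpa using (hR.mono (by omega)).one_sub_X_mul.one_sub_X_mul
    | 1 =>
      have := hR.one_sub_X_mul_powerSumPoly_one_mul.one_sub_X_mul
      refine HasCoeffOrder.mono (d := j / 2 - 1) ?_ (by omega)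
      simpa only [pow_one] using this
    | i + 2 =>
      have := (hR.powerSumPoly_one_pow_mul i).one_sub_X_mul_powerSumPoly_one_mul
      have := this.one_sub_X_mul_powerSumPoly_one_mul
      refine HasCoeffOrder.mono (d := i + (j / 2 - 1)) ?_ (by omega)
      convert this using 2 with n
      ring
  | add u v _ _ hu hv => simpa only [mul_add] using hu.add hv

end IsPowerSumRemainder

/-- The polynomial `subsetSumPoly b n` is the divided power of the first power sum, up to a
remainder. -/
theorem isPowerSumRemainder_subsetSumPoly_sub (b : ℕ) :
    IsPowerSumRemainder b
      (fun n => subsetSumPoly b n - (1 / (b.factorial : ℚ)) • powerSumPoly 1 n ^ b) := by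
  induction b using Nat.strong_induction_on with
  | _ b ih =>
    cases b with
    | zero => simpa using IsPowerSumRemainder.zero
    | succ b =>
      have h1 := (ih b (by omega)).powerSumPoly_one_mul
      -- In Newton's identity the `k = 1` term carries the leading power of P. Every term with `k ≥
      -- 2` is remainder, including the part coming from the leading power in `subsetSumPoly (b + 1
      -- - k) n`.
      have h2 : ∀ k ∈ Finset.Icc 2 (b + 1), IsPowerSumRemainder (b + 1)
          (fun n => ((-1) ^ (k + 1) : ℚ) • (powerSumPoly k n * subsetSumPoly (b + 1 - k) n)) := by
        intro k hk
        rw [Finset.mem_Icc] at hk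
        have h3 := (ih (b + 1 - k) (by omega)).powerSumPoly_mul hk.1
        have h4 := (IsPowerSumRemainder.term (b := b + 1) (b + 1 - k) k (powerSumPoly k) (by omega)
          hk.1 ((HasCoeffOrder.powerSumPoly (by omega)).mono (by omega))).smul
          (1 / ((b + 1 - k).factorial : ℚ))
        rw [show b + 1 - k + k = b + 1 by omega] at h3
        have h5 := (h3.add _ _ h4).smul ((-1) ^ (k + 1))
        convert h5 using 3 with n
        rw [mul_sub, mul_smul_comm, mul_comm (powerSumPoly k n) (powerSumPoly 1 n ^ _)]
        simp
      have h6 := ((h1.add _ _ (IsPowerSumRemainder.sum _ h2)).smul (1 / ((b + 1 : ℕ) : ℚ)))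
      convert h6 using 2 with n
      have hN := newton_subsetSumPoly (b + 1) n
      rw [← Finset.add_sum_Ioc_eq_sum_Icc (by omega : 1 ≤ b + 1)] at hN
      have hI : Finset.Ioc 1 (b + 1) = Finset.Icc 2 (b + 1) := by
        ext i; simp only [Finset.mem_Ioc, Finset.mem_Icc]; omega
      rw [hI, Nat.add_sub_cancel] at hN
      have hb : ((b + 1 : ℕ) : ℚ) ≠ 0 := by positivity
      have hN' : ∑ k ∈ Finset.Icc 2 (b + 1),
          ((-1) ^ (k + 1) : ℚ) • (powerSumPoly k n * subsetSumPoly (b + 1 - k) n) =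
          ((b + 1 : ℕ) : ℚ) • subsetSumPoly (b + 1) n - powerSumPoly 1 n * subsetSumPoly b n := by
        rw [Nat.cast_smul_eq_nsmul, nsmul_eq_mul, hN, eq_sub_iff_add_eq', ← sub_eq_iff_eq_add']
        simp only [Polynomial.smul_eq_C_mul, map_pow, map_neg, map_one]
        rw [mul_comm (subsetSumPoly b n)]
        norm_num
        exact Finset.sum_congr rfl fun k _ => by ring
      rw [hN', mul_sub, mul_smul_comm, ← pow_succ', sub_add_sub_cancel', smul_sub, smul_smul,
        smul_smul, one_div_mul_cancel hb, one_smul, Nat.factorial_succ]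
      congr 2
      push_cast
      field_simp

/-! ### Powers of the first power sum: symmetry and decay from the centre -/

/-- The coefficients of the `m`-th power of `powerSumPoly 1 n`. -/
noncomputable def powerCoeff (m n : ℕ) (l : ℤ) : ℚ := zcoeff l (powerSumPoly 1 n ^ m)

theorem powerCoeff_succ_sub (m n : ℕ) (l : ℤ) :
    powerCoeff (m + 1) n (l + 1) - powerCoeff (m + 1) n l =
      powerCoeff m n l - powerCoeff m n (l - n) := by
  unfold powerCoeff
  rw [pow_succ']
  exact zcoeff_powerSumPoly_one_mul_succ n _ l

theorem powerCoeff_succ (m n : ℕ) (l : ℤ) :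
    powerCoeff (m + 1) n l = ∑ i ∈ Finset.Icc 1 n, powerCoeff m n (l - i) := by
  unfold powerCoeff
  rw [pow_succ']
  nth_rw 1 [powerSumPoly]
  rw [Finset.sum_mul, map_sum]
  exact Finset.sum_congr rfl fun i _ => by rw [zcoeff_X_pow_mul, one_mul]

theorem powerCoeff_symm (m n : ℕ) (l : ℤ) :
    powerCoeff m n (m * (n + 1) - l) = powerCoeff m n l := by
  induction m generalizing l with
  | zero => simp [powerCoeff, zcoeff_one]
  | succ m ih =>
    rw [powerCoeff_succ, powerCoeff_succ]
    refine Finset.sum_nbij' (fun i => n + 1 - i) (fun i => n + 1 - i) ?_ ?_ ?_ ?_ ?_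
    · intro i hi; rw [Finset.mem_Icc] at hi ⊢; omega
    · intro i hi; rw [Finset.mem_Icc] at hi ⊢; omega
    · intro i hi; rw [Finset.mem_Icc] at hi; omega
    · intro i hi; rw [Finset.mem_Icc] at hi; omega
    · intro i hi
      rw [Finset.mem_Icc] at hi
      rw [← ih (l - _)]
      congr 1
      push_cast [Nat.cast_sub (by omega : i ≤ n + 1)]
      ring

theorem exists_left_of_centre (m n : ℕ) (l : ℤ) :
    ∃ l₀ : ℤ, powerCoeff m n l₀ = powerCoeff m n l ∧
      (m * (n + 1) : ℤ) - 2 * l₀ = |2 * l - m * (n + 1)| := by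
  rcases le_or_gt (2 * l) (m * (n + 1)) with h | h
  · exact ⟨l, rfl, by rw [abs_of_nonpos (by linarith)]; ring⟩
  · exact ⟨m * (n + 1) - l, powerCoeff_symm m n l, by rw [abs_of_pos (by linarith)]; ring⟩

theorem powerCoeff_le_of_left {m n : ℕ} {l l' : ℤ}
    (hs : ∀ j : ℤ, 2 * j + 1 ≤ m * (n + 1) → powerCoeff m n j ≤ powerCoeff m n (j + 1))
    (h : l' ≤ l) (hl : 2 * l ≤ m * (n + 1)) : powerCoeff m n l' ≤ powerCoeff m n l := by
  induction l, h using Int.leInduction with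
  | base => exact le_rfl
  | succ j hj ih => exact (ih (by linarith)).trans (hs j (by linarith))

theorem abs_le_abs_sub_of_le {w a : ℤ} (ha : 0 ≤ a) (h : w ≤ a) : |w| ≤ |w - 2 * a| := by
  simp only [abs_eq_max_neg]
  omega

/-- The coefficients of a power of `powerSumPoly 1 n` decrease with the distance from the
centre. -/
theorem powerCoeff_le_powerCoeff {m n : ℕ} (hm : 1 ≤ m) {l l' : ℤ}
    (h : |2 * l - m * (n + 1)| ≤ |2 * l' - m * (n + 1)|) :
    powerCoeff m n l' ≤ powerCoeff m n l := by
  induction m, hm using Nat.le_induction generalizing l l' with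
  | base =>
    unfold powerCoeff
    rw [pow_one, zcoeff_powerSumPoly le_rfl (by norm_num), zcoeff_powerSumPoly le_rfl (by norm_num),
      Int.cast_le]
    unfold powerSumCoeff
    push_cast at h ⊢
    simp only [Int.ediv_one, abs_eq_max_neg] at h ⊢
    omega
  | succ m hm ih =>
    obtain ⟨l₀, h1, h2⟩ := exists_left_of_centre (m + 1) n l
    obtain ⟨l₁, h3, h4⟩ := exists_left_of_centre (m + 1) n l'
    rw [← h1, ← h3]
    refine powerCoeff_le_of_left (fun j hj => ?_) (by omega) 
      (by linarith [abs_nonneg (2 * l - ((m + 1 : ℕ) : ℤ) * (n + 1))])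
    -- A step of the (m+1)-st power compares the m-th power at `j` and at `j - n`; left of the
    -- centre, `j` is the closer of the two to the centre of the m-th power.
    rw [← sub_nonneg, powerCoeff_succ_sub, sub_nonneg]
    apply ih
    rw [show 2 * (j - n) - (m * (n + 1) : ℤ) = 2 * j - m * (n + 1) - 2 * n by ring]
    apply abs_le_abs_sub_of_le (by omega)
    push_cast at hj
    linarith

theorem mul_le_powerCoeff_sub {m n : ℕ} {c : ℚ} (T : ℕ) (l : ℤ)
    (h : ∀ j : ℤ, l ≤ j → j < l + T → c ≤ powerCoeff m n (j + 1) - powerCoeff m n j) :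
    T * c ≤ powerCoeff m n (l + T) - powerCoeff m n l := by
  induction T with
  | zero => simp
  | succ T ih =>
    have h1 := ih fun j hj hj' => h j hj (by push_cast; omega)
    have h2 := h (l + T) (by omega) (by push_cast; omega)
    push_cast
    rw [← add_assoc]
    linarith

/-- A quantitative form of `powerCoeff_le_powerCoeff`. -/
theorem exists_pow_le_powerCoeff_sub {m : ℕ} (hm : 2 ≤ m) :
    ∃ K : ℕ, 0 < K ∧ ∀ (n T : ℕ) (l l' : ℤ), (K * T : ℤ) ≤ n →
      |2 * l - m * (n + 1)| + K * T ≤ |2 * l' - m * (n + 1)| →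
      |2 * l - m * (n + 1)| + K * T ≤ m * n →
      (T : ℚ) ^ (m - 1) ≤ powerCoeff m n l - powerCoeff m n l' := by
  induction m, hm using Nat.le_induction with
  | base =>
    -- The tent has slope one, and distances to the centre are measured doubled.
    refine ⟨2, two_pos, fun n T l l' _ h1 h2 => ?_⟩
    unfold powerCoeff
    rw [pow_two (powerSumPoly 1 n), zcoeff_powerSumPoly_one_mul_one,
      zcoeff_powerSumPoly_one_mul_one]
    have : (T : ℤ) ≤ tentCoeff n l - tentCoeff n l' := by
      unfold tentCoeff
      push_cast at h1 h2
      simp only [abs_eq_max_neg] at h1 h2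
      omega
    have := (Int.cast_le (R := ℚ)).2 this
    push_cast at this
    simpa using this
  | succ m hm ih =>
    obtain ⟨K, hK, ih⟩ := ih
    -- From a point left of the centre, move left by `K * T` to gain clearance, then make `T` steps
    -- that each lose at least T^(m-1) by induction. The doubled displacement is `(2 * K + 2) * T`;
    -- the other `K * T` keeps the points inside the support, as the induction hypothesis demands.
    refine ⟨3 * K + 2, by omega, fun n T l l' h0 h1 h2 => ?_⟩
    obtain ⟨l₀, h3, h4⟩ := exists_left_of_centre (m + 1) n l
    obtain ⟨l₁, h5, h6⟩ := exists_left_of_centre (m + 1) n l'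
    rw [← h3, ← h5]
    rw [← h4] at h1 h2
    rw [← h6] at h1
    have hnn : 0 ≤ ((m + 1 : ℕ) * (n + 1) : ℤ) - 2 * l₀ := by rw [h4]; positivity
    clear h3 h4 h5 h6
    push_cast at h0 h1 h2 hnn
    have hKT : (0 : ℤ) ≤ K * T := by positivity
    have hT : (0 : ℤ) ≤ T := by positivity
    have e1 : powerCoeff (m + 1) n (l₀ - K * T) ≤ powerCoeff (m + 1) n l₀ := by
      apply powerCoeff_le_powerCoeff (by omega)
      push_cast
      rw [abs_of_nonpos (by linarith), abs_of_nonpos (by linarith)]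
      linarith
    have e2 : powerCoeff (m + 1) n l₁ ≤ powerCoeff (m + 1) n (l₀ - K * T - T) := by
      apply powerCoeff_le_powerCoeff (by omega)
      push_cast
      rw [abs_of_nonpos (by linarith), abs_of_nonpos (by linarith)]
      linarith
    have e3 := mul_le_powerCoeff_sub (m := m + 1) (n := n) (c := (T : ℚ) ^ (m - 1)) T
      (l₀ - K * T - T) (by
        intro j hj hj'
        rw [powerCoeff_succ_sub]
        have hw1 : 2 * j - (m * (n + 1) : ℤ) ≤ n - 1 - 2 * (K * T) := by linarith
        have hw2 : -(m * n - K * T : ℤ) ≤ 2 * j - (m * (n + 1) : ℤ) := by linarith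
        have hmn : (2 * n : ℤ) ≤ m * n := by
          have : (2 : ℤ) ≤ m := by exact_mod_cast hm
          exact mul_le_mul_of_nonneg_right this (by omega)
        have hKn : (K * T : ℤ) ≤ n := by linarith
        apply ih n T _ _ hKn
        · rw [show 2 * (j - n) - (m * (n + 1) : ℤ) = 2 * j - m * (n + 1) - 2 * n by ring]
          generalize (K * T : ℤ) = a at *
          generalize 2 * j - (m * (n + 1) : ℤ) = w at *
          simp only [abs_eq_max_neg]
          omega
        · generalize (K * T : ℤ) = a at *
          generalize 2 * j - (m * (n + 1) : ℤ) = w at *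
          generalize (m * n : ℤ) = p at *
          simp only [abs_eq_max_neg]
          omega)
    have e4 : (T : ℚ) ^ (m + 1 - 1) = T * (T : ℚ) ^ (m - 1) := by
      rw [← pow_succ']; congr 1; omega
    rw [e4]
    rw [sub_add_cancel] at e3
    linarith

/-! ### First and second differences up to lower order -/

theorem hasCoeffOrder_one_sub_X_mul_powerSumPoly_one_pow (a : ℕ) :
    HasCoeffOrder (fun n => (1 - Polynomial.X) * powerSumPoly 1 n ^ a) (a - 2) := by
  cases a with
  | zero => simpa using HasCoeffOrder.one.one_sub_X_mul
  | succ a =>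
    have := (HasCoeffOrder.powerSumPoly_one_pow a).one_sub_X_mul_powerSumPoly_one_mul
    rw [show a + 1 - 2 = a - 1 by omega]
    simpa only [pow_succ'] using this

theorem hasCoeffOrder_one_sub_X_sq_mul_powerSumPoly_one_pow (a : ℕ) :
    HasCoeffOrder (fun n => (1 - Polynomial.X) * ((1 - Polynomial.X) * powerSumPoly 1 n ^ a))
      (a - 3) := by
  cases a with
  | zero => simpa using HasCoeffOrder.one.one_sub_X_mul.one_sub_X_mul
  | succ a =>
    have := (hasCoeffOrder_one_sub_X_mul_powerSumPoly_one_pow a).one_sub_X_mul_powerSumPoly_one_mul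
    rw [show a + 1 - 3 = a - 2 by omega]
    convert this using 2 with n
    ring

theorem hasCoeffOrder_one_sub_X_mul_subsetSumPoly (a : ℕ) :
    HasCoeffOrder (fun n => (1 - Polynomial.X) * subsetSumPoly a n) (a - 2) := by
  have h1 := (isPowerSumRemainder_subsetSumPoly_sub a).hasCoeffOrder_one_sub_X_mul (d := a - 2)
    (by omega)
  have h2 := (hasCoeffOrder_one_sub_X_mul_powerSumPoly_one_pow a).smul (1 / (a.factorial : ℚ))
  convert h1.add h2 using 2 with n
  rw [mul_sub, mul_smul_comm]
  ring

theorem hasCoeffOrder_one_sub_X_sq_mul_subsetSumPoly (a : ℕ) :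
    HasCoeffOrder (fun n => (1 - Polynomial.X) * ((1 - Polynomial.X) * subsetSumPoly a n))
      (a - 3) := by
  have h1 := (isPowerSumRemainder_subsetSumPoly_sub a).hasCoeffOrder_one_sub_X_sq_mul (d := a - 3)
    (by omega) (by omega)
  have h2 := (hasCoeffOrder_one_sub_X_sq_mul_powerSumPoly_one_pow a).smul (1 / (a.factorial : ℚ))
  convert h1.add h2 using 2 with n
  rw [mul_sub, mul_sub, mul_smul_comm, mul_smul_comm]
  ring

theorem zcoeff_succ_one_sub_X_mul (l : ℤ) (p : Polynomial ℚ) :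
    zcoeff (l + 1) ((1 - Polynomial.X) * p) = zdiff l p := by
  rw [zcoeff_one_sub_X_mul, add_sub_cancel_right, zdiff_apply]

theorem zcoeff_add_two_one_sub_X_sq_mul (l : ℤ) (p : Polynomial ℚ) :
    zcoeff (l + 1 + 1) ((1 - Polynomial.X) * ((1 - Polynomial.X) * p)) =
      zdiff (l + 1) p - zdiff l p := by
  rw [zcoeff_one_sub_X_mul, zcoeff_succ_one_sub_X_mul, add_sub_cancel_right,
    zcoeff_succ_one_sub_X_mul]

/-- The sum of the polynomials `subsetSumPoly a n` for `a ≤ b`. -/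
noncomputable def truncatedPoly (b n : ℕ) : Polynomial ℚ :=
  ∑ a ∈ Finset.range (b + 1), subsetSumPoly a n

theorem truncatedCoeff_succ_sub (b n : ℕ) (l : ℤ) :
    truncatedCoeff b n (l + 1) - truncatedCoeff b n l = zdiff l (truncatedPoly b n) := by
  rw [truncatedCoeff_sub, truncatedPoly, map_sum]

/-- Only P^b / b! reaches order b - 2. The remainder has order b - 3, as do the subsets with `a < b`
elements, whose differences have order a - 2. -/
theorem exists_abs_zdiff_truncatedPoly_sub_le {b : ℕ} (hb : 5 ≤ b) :
    ∃ C : ℚ, 0 ≤ C ∧ ∀ n : ℕ, 1 ≤ n → ∀ l : ℤ,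
      |b.factorial * zdiff l (truncatedPoly b n) -
        (powerCoeff (b - 1) n l - powerCoeff (b - 1) n (l - n))| ≤ C * (n : ℚ) ^ (b - 3) := by
  have h1 := (isPowerSumRemainder_subsetSumPoly_sub b).hasCoeffOrder_one_sub_X_mul (d := b - 3)
    (by omega)
  have h2 : HasCoeffOrder (fun n => ∑ a ∈ Finset.range b,
      (1 - Polynomial.X) * subsetSumPoly a n) (b - 3) :=
    HasCoeffOrder.sum _ fun a ha => (hasCoeffOrder_one_sub_X_mul_subsetSumPoly a).mono
      (by have := Finset.mem_range.1 ha; omega)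
  obtain ⟨C, hC, h⟩ := (h2.add h1).smul b.factorial
  refine ⟨C, hC, fun n hn l => ?_⟩
  convert h n hn (l + 1) using 2
  beta_reduce
  rw [← Finset.mul_sum, ← mul_add, ← add_sub_assoc, ← Finset.sum_range_succ, map_smul,
    zcoeff_succ_one_sub_X_mul, map_sub, map_smul, smul_eq_mul, smul_eq_mul, mul_sub, ← mul_assoc,
    mul_one_div_cancel (by positivity), one_mul, truncatedPoly]
  congr 1
  obtain ⟨b, rfl⟩ : ∃ b', b = b' + 1 := ⟨b - 1, by omega⟩
  rw [Nat.add_sub_cancel, ← powerCoeff_succ_sub]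
  rfl

/-- The same comparison one order lower, with two factors P removed from the leading term. -/
theorem exists_abs_zdiff_zdiff_truncatedPoly_sub_le {b : ℕ} (hb : 5 ≤ b) :
    ∃ C : ℚ, 0 ≤ C ∧ ∀ n : ℕ, 1 ≤ n → ∀ l : ℤ,
      |b.factorial * (zdiff (l + 1) (truncatedPoly b n) - zdiff l (truncatedPoly b n)) -
        (powerCoeff (b - 2) n l - 2 * powerCoeff (b - 2) n (l - n) +
          powerCoeff (b - 2) n (l - 2 * n))| ≤ C * (n : ℚ) ^ (b - 4) := by
  have h1 := (isPowerSumRemainder_subsetSumPoly_sub b).hasCoeffOrder_one_sub_X_sq_mul (d := b - 4)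
    (by omega) (by omega)
  have h2 : HasCoeffOrder (fun n => ∑ a ∈ Finset.range b,
      (1 - Polynomial.X) * ((1 - Polynomial.X) * subsetSumPoly a n)) (b - 4) :=
    HasCoeffOrder.sum _ fun a ha => (hasCoeffOrder_one_sub_X_sq_mul_subsetSumPoly a).mono
      (by have := Finset.mem_range.1 ha; omega)
  obtain ⟨C, hC, h⟩ := (h2.add h1).smul b.factorial
  refine ⟨C, hC, fun n hn l => ?_⟩
  convert h n hn (l + 1 + 1) using 2
  beta_reduce
  rw [← Finset.mul_sum, ← Finset.mul_sum, ← mul_add, ← mul_add, ← add_sub_assoc,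
    ← Finset.sum_range_succ, map_smul, zcoeff_add_two_one_sub_X_sq_mul, map_sub, map_sub, map_smul,
    map_smul, smul_eq_mul, smul_eq_mul, smul_eq_mul, truncatedPoly]
  have hf : (b.factorial : ℚ) ≠ 0 := by positivity
  obtain ⟨b, rfl⟩ : ∃ b', b = b' + 2 := ⟨b - 2, by omega⟩
  have e : ∀ l, zdiff l (powerSumPoly 1 n ^ (b + 2)) =
      powerCoeff (b + 1) n l - powerCoeff (b + 1) n (l - n) := by
    intro l
    rw [← powerCoeff_succ_sub]
    rfl
  have e1 := powerCoeff_succ_sub b n l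
  have e2 := powerCoeff_succ_sub b n (l - n)
  rw [show l - (n : ℤ) + 1 = l + 1 - n by ring, show l - (n : ℤ) - n = l - 2 * n by ring] at e2
  rw [e, e, Nat.add_sub_cancel]
  field_simp
  linear_combination e1 - e2

/-! ### Unimodality for `b ≥ 5` -/

theorem exists_mul_pow_lt_pow_div {K : ℕ} (hK : 0 < K) (C : ℚ) (d : ℕ) :
    ∃ N : ℕ, ∀ n : ℕ, N ≤ n → C * (n : ℚ) ^ d < ((n / K : ℕ) : ℚ) ^ (d + 1) := by
  obtain ⟨M, hM⟩ := exists_nat_gt (|C| * (2 * K) ^ (d + 1))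
  refine ⟨M + 2 * K + 1, fun n hn => ?_⟩
  have hn0 : (0 : ℚ) < n := by exact_mod_cast (by omega : 0 < n)
  have hKq : (0 : ℚ) < K := by exact_mod_cast hK
  have h1 : (n : ℚ) ≤ 2 * K * ((n / K : ℕ) : ℚ) := by
    have h2 := Nat.div_add_mod n K
    have h3 := Nat.mod_lt n hK
    have h4 : n ≤ 2 * K * (n / K) := by nlinarith
    exact_mod_cast h4
  have h2 : (n : ℚ) ^ (d + 1) ≤ (2 * K) ^ (d + 1) * ((n / K : ℕ) : ℚ) ^ (d + 1) := by
    rw [← mul_pow]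
    gcongr
  have h3 : |C| * (2 * K) ^ (d + 1) < n := hM.trans (by exact_mod_cast (by omega : M < n))
  have h4 : C * (n : ℚ) ^ d * (2 * K) ^ (d + 1) < (n : ℚ) ^ (d + 1) := by
    calc C * (n : ℚ) ^ d * (2 * K) ^ (d + 1) ≤ |C| * (n : ℚ) ^ d * (2 * K) ^ (d + 1) := by
          gcongr; exact le_abs_self C
      _ = |C| * (2 * K) ^ (d + 1) * (n : ℚ) ^ d := by ring
      _ < n * (n : ℚ) ^ d := by gcongr
      _ = (n : ℚ) ^ (d + 1) := by ring
  have h5 : (0 : ℚ) < (2 * K) ^ (d + 1) := by positivity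
  rw [← mul_lt_mul_iff_left₀ h5]
  linarith

theorem exists_isUnimodalPoly_rankGeneratingPoly {b : ℕ} (hb : 5 ≤ b) :
    ∃ N : ℕ, ∀ n : ℕ, N ≤ n → IsUnimodalPoly (rankGeneratingPoly n b) := by
  obtain ⟨K₁, hK₁, hP₁⟩ := exists_pow_le_powerCoeff_sub (m := b - 1) (by omega)
  obtain ⟨K₂, hK₂, hP₂⟩ := exists_pow_le_powerCoeff_sub (m := b - 2) (by omega)
  obtain ⟨C₁, hC₁, hD₁⟩ := exists_abs_zdiff_truncatedPoly_sub_le hb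
  obtain ⟨C₂, hC₂, hD₂⟩ := exists_abs_zdiff_zdiff_truncatedPoly_sub_le hb
  obtain ⟨N₁, hN₁⟩ := exists_mul_pow_lt_pow_div (K := 2 * (K₁ + K₂)) (by omega) C₁ (b - 3)
  obtain ⟨N₂, hN₂⟩ := exists_mul_pow_lt_pow_div (K := 2 * (K₁ + K₂)) (by omega) C₂ (b - 4)
  refine ⟨N₁ + N₂ + b + 4, fun n hn => isUnimodalPoly_of_no_valley (by omega) ?_⟩
  have hN₁ := hN₁ n (by omega)
  have hN₂ := hN₂ n (by omega)
  have hD₁ := hD₁ n (by omega)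
  have hD₂ := hD₂ n (by omega)
  have hT : 2 * (K₁ + K₂) * (n / (2 * (K₁ + K₂))) ≤ n := Nat.mul_div_le _ _
  -- `T` is a fixed proportion of `n`, so its powers beat the error terms, yet small enough that `K₁
  -- * T` and `K₂ * T` are at most `n / 2`.
  set T := n / (2 * (K₁ + K₂)) with hTdef
  have hP₁ := hP₁ n T
  have hP₂ := hP₂ n T
  have hKT₁ : 2 * (K₁ * T : ℤ) ≤ n := by
    have : 2 * (K₁ * T) ≤ n := by nlinarith
    exact_mod_cast this
  have hKT₂ : 2 * (K₂ * T : ℤ) ≤ n := by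
    have : 2 * (K₂ * T) ≤ n := by nlinarith
    exact_mod_cast this
  have hKT₁' : (0 : ℤ) ≤ K₁ * T := by positivity
  have hKT₂' : (0 : ℤ) ≤ K₂ * T := by positivity
  have hbn : (b + 4 : ℤ) ≤ n := by exact_mod_cast (by omega : b + 4 ≤ n)
  have hbn3 : (3 * n : ℤ) ≤ (b - 2) * n := by
    have : (3 : ℤ) ≤ b - 2 := by omega
    exact mul_le_mul_of_nonneg_right this (by omega)
  have hc1 : ((b - 1 : ℕ) : ℤ) = b - 1 := by omega
  have hc2 : ((b - 2 : ℕ) : ℤ) = b - 2 := by omega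
  rw [show b - 1 - 1 = b - 3 + 1 by omega, hc1] at hP₁
  rw [show b - 2 - 1 = b - 4 + 1 by omega, hc2] at hP₂
  have hfac : (0 : ℚ) < b.factorial := by positivity
  -- The quantity v = 2l + 2 - b(n + 1) locates `l` relative to the centre. The three regions are 2v
  -- ≤ -n, 2v ≥ n and the strip between.
  have left : ∀ l : ℤ, n ≤ l → 2 * (2 * l + 2 - b * (n + 1)) ≤ -n →
      0 ≤ zdiff l (truncatedPoly b n) := by
    intro l hl hv
    have h1 := hP₁ l (l - n) (by linarith) (by
      rw [show 2 * (l - n) - ((b - 1) * (n + 1) : ℤ) = 2 * l - (b - 1) * (n + 1) - 2 * n by ring]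
      have hw : 2 * (2 * l - (b - 1) * (n + 1) : ℤ) ≤ n := by linarith
      generalize 2 * l - ((b - 1) * (n + 1) : ℤ) = w at *
      simp only [abs_eq_max_neg]
      omega) (by
      have hw : 2 * (2 * l - (b - 1) * (n + 1) : ℤ) ≤ n := by linarith
      have hw' : 2 * n - (b - 1) - (b - 1) * n ≤ (2 * l - (b - 1) * (n + 1) : ℤ) := by linarith
      have hbn3' : (4 * n : ℤ) ≤ (b - 1) * n := by linarith
      generalize 2 * l - ((b - 1) * (n + 1) : ℤ) = w at *
      generalize ((b - 1) * n : ℤ) = p at *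
      simp only [abs_eq_max_neg]
      omega)
    have h2 := (abs_le.1 (hD₁ l)).1
    refine (mul_nonneg_iff_of_pos_left hfac).1 ?_
    linarith
  have right : ∀ l : ℤ, l ≤ (b - 1) * (n + 1) → n ≤ 2 * (2 * l + 2 - b * (n + 1)) →
      zdiff l (truncatedPoly b n) ≤ 0 := by
    intro l hl hv
    have h1 := hP₁ (l - n) l (by linarith) (by
      rw [show 2 * (l - n) - ((b - 1) * (n + 1) : ℤ) = 2 * l - (b - 1) * (n + 1) - 2 * n by ring]
      have hw : 3 * n - 2 ≤ 2 * (2 * l - (b - 1) * (n + 1) : ℤ) := by linarith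
      generalize 2 * l - ((b - 1) * (n + 1) : ℤ) = w at *
      simp only [abs_eq_max_neg]
      omega) (by
      rw [show 2 * (l - n) - ((b - 1) * (n + 1) : ℤ) = 2 * l - (b - 1) * (n + 1) - 2 * n by ring]
      have hw : 3 * n - 2 ≤ 2 * (2 * l - (b - 1) * (n + 1) : ℤ) := by linarith
      have hw' : (2 * l - (b - 1) * (n + 1) : ℤ) ≤ (b - 1) + (b - 1) * n := by linarith
      have hbn3' : (4 * n : ℤ) ≤ (b - 1) * n := by linarith
      generalize 2 * l - ((b - 1) * (n + 1) : ℤ) = w at *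
      generalize ((b - 1) * n : ℤ) = p at *
      simp only [abs_eq_max_neg]
      omega)
    have h2 := (abs_le.1 (hD₁ l)).2
    refine (mul_nonpos_iff_pos_imp_nonpos.1 ?_).1 hfac
    linarith
  -- Here v is also the doubled offset of `l - n` from the centre of P^(b-2). In the strip `l - n`
  -- is much closer to that centre than `l` and `l - 2 * n` are, so the second difference is
  -- negative beyond the error.
  have centre : ∀ l : ℤ, -n ≤ 2 * (2 * l + 2 - b * (n + 1)) →
      2 * (2 * l + 2 - b * (n + 1)) ≤ n →
      zdiff (l + 1) (truncatedPoly b n) ≤ zdiff l (truncatedPoly b n) := by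
    intro l hv hv'
    have e : ∀ k : ℤ, 2 * (l - k * n) - ((b - 2) * (n + 1) : ℤ) =
        2 * l + 2 - b * (n + 1) + (2 - 2 * k) * n := fun k => by ring
    have e0 := e 0
    have e1 := e 1
    have e2 := e 2
    norm_num at e0 e1 e2
    have hb3 : |2 * (l - n) - ((b - 2) * (n + 1) : ℤ)| + K₂ * T ≤ (b - 2) * n := by
      rw [e1]
      generalize 2 * l + 2 - (b * (n + 1) : ℤ) = v at *
      generalize ((b - 2) * n : ℤ) = p at *
      simp only [abs_eq_max_neg]
      omega
    have h1 := hP₂ (l - n) l (by linarith) (by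
      rw [e0, e1]
      generalize 2 * l + 2 - (b * (n + 1) : ℤ) = v at *
      simp only [abs_eq_max_neg]
      omega) hb3
    have h2 := hP₂ (l - n) (l - 2 * n) (by linarith) (by
      rw [e1, e2]
      generalize 2 * l + 2 - (b * (n + 1) : ℤ) = v at *
      simp only [abs_eq_max_neg]
      omega) hb3
    have h3 := (abs_le.1 (hD₂ l)).2
    have h4 : (0 : ℚ) ≤ (T : ℚ) ^ (b - 4 + 1) := by positivity
    rw [← sub_nonpos]
    refine (mul_nonpos_iff_pos_imp_nonpos.1 ?_).1 hfac
    linarith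
  have centre' : ∀ l l' : ℤ, l ≤ l' → -n ≤ 2 * (2 * l + 2 - b * (n + 1)) →
      2 * (2 * l' + 2 - b * (n + 1)) ≤ n →
      zdiff l' (truncatedPoly b n) ≤ zdiff l (truncatedPoly b n) := by
    intro l l' hll' hv hv'
    induction l', hll' using Int.leInduction with
    | base => exact le_rfl
    | succ j hj ih => exact (centre j (by linarith) (by linarith)).trans (ih (by linarith))
  intro l l' hl hll' hl' hneg
  rw [← sub_neg, truncatedCoeff_succ_sub] at hneg
  rw [← sub_nonpos, truncatedCoeff_succ_sub]
  -- A strict descent at `l` rules out the left region, so unless `l'` is in the right region both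
  -- lie in the strip, where first differences decrease.
  rcases le_or_gt (n : ℤ) (2 * (2 * l' + 2 - b * (n + 1))) with h | h
  · exact right l' hl' h
  rcases le_or_gt (2 * (2 * l + 2 - b * (n + 1))) (-n : ℤ) with h' | h'
  · exact absurd (left l hl h') (not_le.2 hneg)
  · exact (centre' l l' hll'.le h'.le h.le).trans hneg.le

theorem theorem1 (b : ℕ) :
    (∀ n : ℕ,
      algebraMap (Polynomial ℚ) (RatFunc ℚ)
          ((rankGeneratingPoly n b).map (Nat.castRingHom ℚ)) =
        ∑ a ∈ Finset.range (b + 1),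
          RatFunc.X ^ (a * (a + 1) / 2) * gaussianBinomial n a) ∧
    ∃ N : ℕ, ∀ n : ℕ, N ≤ n → IsUnimodalPoly (rankGeneratingPoly n b) := by
  refine ⟨fun n => algebraMap_rankGeneratingPoly n b, ?_⟩
  rcases lt_or_ge b 5 with hb | hb
  · refine ⟨1000, fun n hn => ?_⟩
    interval_cases b
    · exact isUnimodalPoly_rankGeneratingPoly_zero n
    · exact isUnimodalPoly_rankGeneratingPoly_one (by omega)
    · exact isUnimodalPoly_rankGeneratingPoly_two (by omega)
    · exact isUnimodalPoly_rankGeneratingPoly_three (by omega)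
    · exact isUnimodalPoly_rankGeneratingPoly_four hn
  · exact exists_isUnimodalPoly_rankGeneratingPoly hb
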